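/- All compact spaces are assumed to be Hausdorff. Let $X$ be a topological space. For an infinite regular cardinal $\kappa$, a sequence $\{x_\alpha:\alpha<\kappa\}$ of points of $X$ converges to $x\in X$ if every neighbourhood $U$ of $x$ satisfies $|\{\alpha<\kappa: x_\alpha\notin U\}|<\kappa$. A set $A\subseteq X$ is radially closed if no sequence $\{x_\alpha:\alpha<\kappa\}\subseteq A$, with $\kappa$ an infinite regular cardinal, converges to a point of $X\setminus A$; the radial closure of $A$ is the smallest radially closed set containing $A$. The space $X$ is pseudoradial if the radial closure of every subset of $X$ is closed, and weakly pseudoradial if the radial closure of every countable subset of $X$ is closed. Let $\mathfrak{pse}$ be the least cardinal $\kappa$ such that the product space $2^\kappa=\{0,1\}^\kappa$ (with $\{0,1\}$ discrete) is not pseudoradial. **Theorem.** Suppose $\mathfrak{pse}\le\aleph_2$. Let $X$ and $Y$ be compact pseudoradial spaces such that $X\times Y$ is weakly pseudoradial. Then $X\times Y$ is pseudoradial. -/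

import Mathlib

open Topology Cardinal

universe u v

/-- A sequence `(s α)_{α < κ}`, indexed by the ordinals below the cardinal `κ`, converges to `x`:
every neighbourhood of `x` leaves out fewer than `κ` of the members (counted by their index). -/
def TransfiniteConverges {X : Type u} [TopologicalSpace X] {κ : Cardinal.{u}}
    (s : κ.ord.ToType → X) (x : X) : Prop :=
  ∀ U ∈ 𝓝 x, #{α : κ.ord.ToType | s α ∉ U} < κ

/-- `A` is radially closed: no sequence in `A` whose length is an (infinite) regular cardinal
converges to a point outside `A`. Lengths `κ` in the universe of `X` suffice: if `κ` is regular and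
larger than the cardinality of `X`, then some value is taken `κ` times, and the constant sequence
of length `ℵ₀` with this value has every limit that the given sequence has. -/
def IsRadiallyClosed {X : Type u} [TopologicalSpace X] (A : Set X) : Prop :=
  ∀ κ : Cardinal.{u}, κ.IsRegular → ∀ s : κ.ord.ToType → X, (∀ α, s α ∈ A) →
    ∀ x : X, TransfiniteConverges s x → x ∈ A

/-- The radial closure of `A`: the smallest radially closed set that contains `A`. -/
def radialClosure {X : Type u} [TopologicalSpace X] (A : Set X) : Set X :=
  ⋂₀ {B : Set X | IsRadiallyClosed B ∧ A ⊆ B}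

/-- The radial closure is indeed the least radially closed superset. -/
theorem isLeast_radialClosure {X : Type u} [TopologicalSpace X] (A : Set X) :
    IsLeast {B : Set X | IsRadiallyClosed B ∧ A ⊆ B} (radialClosure A) := by
  refine ⟨⟨?_, Set.subset_sInter fun B hB => hB.2⟩, fun B hB => Set.sInter_subset_of_mem hB⟩
  intro κ hκ s hs x hx B hB
  exact hB.1 κ hκ s (fun α => hs α B hB) x hx

/-- A space is pseudoradial if the radial closure of every subset is closed. -/
def IsPseudoradial (X : Type u) [TopologicalSpace X] : Prop :=
  ∀ A : Set X, IsClosed (radialClosure A)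

/-- A space is weakly pseudoradial if the radial closure of every countable subset is closed. -/
def IsWeaklyPseudoradial (X : Type u) [TopologicalSpace X] : Prop :=
  ∀ A : Set X, A.Countable → IsClosed (radialClosure A)

/-- The pseudoradial number: the least cardinal `κ` such that the Cantor cube `2 ^ κ`
(with the product topology) is not pseudoradial. -/
noncomputable def pseudoradialNumber : Cardinal.{0} :=
  sInf {κ : Cardinal.{0} | ¬ IsPseudoradial (κ.out → Bool)}

/-- Some Cantor cube is not pseudoradial, so the minimum that defines `pseudoradialNumber`
is attained. -/
theorem pseudoradialNumber_spec :
    ¬ IsPseudoradial (pseudoradialNumber.out → Bool) := by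
  classical
  suffices h : {κ : Cardinal.{0} | ¬ IsPseudoradial (κ.out → Bool)}.Nonempty from csInf_mem h
  refine ⟨#(Set ℕ), fun hps => ?_⟩
  obtain ⟨e⟩ : Nonempty ((#(Set ℕ)).out ≃ Set ℕ) := Cardinal.eq.1 (Cardinal.mk_out _)
  let x : ℕ → (#(Set ℕ)).out → Bool := fun n i => decide (n ∈ e i)
  have hrad : IsRadiallyClosed (Set.range x) := by
    intro κ hκ s hs p hp
    choose f hf using hs
    by_cases hfib : ∃ n, κ ≤ #{α : κ.ord.ToType | f α = n}
    · obtain ⟨n, hn⟩ := hfib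
      refine ⟨n, ?_⟩
      by_contra hne
      have h1 := hp {x n}ᶜ (isOpen_compl_singleton.mem_nhds fun h => hne h.symm)
      refine absurd (hn.trans (Cardinal.mk_le_mk_of_subset ?_)) (not_le.2 h1)
      intro α hα
      simp only [Set.mem_ofPred_eq] at hα
      simp [← hf, hα]
    · push Not at hfib
      exfalso
      have hκ0 : κ = ℵ₀ := by
        by_contra hne
        have hlt : ℵ₀ < κ := lt_of_le_of_ne hκ.aleph0_le (Ne.symm hne)
        obtain ⟨n, hn⟩ := Cardinal.infinite_pigeonhole f (by simpa using hκ.aleph0_le)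
          (by simpa [hκ.cof_ord] using hlt)
        refine absurd (hfib n) (not_lt.2 ?_)
        have h2 : #(f ⁻¹' {n}) = κ := by simpa using hn
        exact h2.ge
      have hinf : (Set.range f).Infinite := by
        intro hfin
        have hcov : (Set.univ : Set κ.ord.ToType) ⊆ ⋃ n ∈ Set.range f, {α | f α = n} := by
          intro α _
          simp
        have hfinu := (hfin.biUnion fun n _ =>
          Cardinal.lt_aleph0_iff_set_finite.1 (hκ0 ▸ hfib n)).subset hcov
        have : #κ.ord.ToType < ℵ₀ := by
          rw [← Cardinal.mk_univ]
          exact Cardinal.lt_aleph0_iff_set_finite.2 hfinu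
        rw [Cardinal.mk_ord_toType, hκ0] at this
        exact lt_irrefl _ this
      have : Infinite (Set.range f) := hinf.to_subtype
      let g : ℕ ↪ Set.range f := Infinite.natEmbedding _
      choose a ha using fun k => (g k).2
      have hinj : Function.Injective fun k => f (a k) := by
        intro k l hkl
        simp only [ha] at hkl
        exact g.injective (Subtype.ext hkl)
      let S : Set ℕ := Set.range fun k => f (a (2 * k))
      let i := e.symm S
      have hval : ∀ k, s (a k) i = decide (Even k) := by
        intro k
        rw [← hf]
        simp only [x, i, Equiv.apply_symm_apply, S, Set.mem_range, decide_eq_decide]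
        constructor
        · rintro ⟨l, hl⟩
          have := hinj hl
          exact ⟨l, by omega⟩
        · rintro ⟨l, hl⟩
          exact ⟨l, by rw [hl, two_mul]⟩
      have hU : (fun y : (#(Set ℕ)).out → Bool => y i) ⁻¹' {p i} ∈ 𝓝 p :=
        ((isOpen_discrete ({p i} : Set Bool)).preimage (continuous_apply i)).mem_nhds rfl
      have hlt := hp _ hU
      have hfin := Cardinal.lt_aleph0_iff_set_finite.1 (hlt.trans_eq hκ0)
      have hainj : Function.Injective a := fun k l h => hinj (by simp [h])
      have hfin2 := hfin.preimage (f := a) hainj.injOn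
      cases hpi : p i with
      | true =>
        refine Set.infinite_of_injective_forall_mem (f := fun k => 2 * k + 1)
          (fun k l h => by simpa using h) (fun k => ?_) hfin2
        simp [hval, hpi]
      | false =>
        refine Set.infinite_of_injective_forall_mem (f := fun k => 2 * k)
          (fun k l h => by simpa using h) (fun k => ?_) hfin2
        simp [hval, hpi]
  have heq : radialClosure (Set.range x) = Set.range x :=
    ((isLeast_radialClosure _).2 ⟨hrad, subset_rfl⟩).antisymm (isLeast_radialClosure _).1.2
  have hcpt : IsCompact (Set.range x) := (heq ▸ hps (Set.range x)).isCompact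
  obtain ⟨t, ht⟩ := hcpt.elim_finite_subcover
    (fun n : ℕ => (fun y : (#(Set ℕ)).out → Bool => y (e.symm {n})) ⁻¹' {true})
    (fun n => (isOpen_discrete ({true} : Set Bool)).preimage (continuous_apply _))
    (by
      rintro _ ⟨n, rfl⟩
      simp [x])
  obtain ⟨m, hm⟩ := Infinite.exists_notMem_finset t
  have := ht ⟨m, rfl⟩
  simp [x] at this
  exact hm this

open Set Filter

/-! ### Index types of regular cardinality -/

/-! Pseudoradiality passes to closed subspaces and to Hausdorff images of compact spaces. As
`pseudoradialNumber ≤ ℵ_ 2`, no closed subspace of a compact pseudoradial space maps onto `2 ^ ℵ₂`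
(`IsPseudoradial.noIndependentFamily`). This weaker property is productive
(`NoIndependentFamily.prod`), and it gives every nonempty closed subspace a point whose
neighbourhoods are traced by `ω₁` many sequences of open sets (`exists_point_filters`).

Let `A ⊆ X × Y` be radially closed. Weak pseudoradiality keeps closures of countable subsets of `A`
inside `A`. Pseudoradiality of the factors puts into `A` a point common to the closures of all tails
of any given `ω₁`-sequence in `A` (`exists_cluster_mem_of_prod`).

Suppose `A` is not closed. Choose a set `I` of continuous functions, of least cardinality, whose
common zeros in `closure A` form a nonempty set `K` missing `A`. With `θ` the cofinality of `#I`,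
`K` is the intersection of a decreasing `θ`-sequence of closed sets that meet `A` by minimality. The
two facts above exclude `θ = ω` and `θ = ω₁`. If `θ > ω₁`, take a traced point `p` of `K`. At each
stage below `θ`, a cluster point along countable sequences and then along `ω₁` yields a point of
`A`, and these points converge to `p ∉ A`, a contradiction (`isClosed_of_isRadiallyClosed`). -/

theorem exists_forall_lt_of_mk_lt {κ : Cardinal.{u}} (hκ : κ.IsRegular)
    {S : Set κ.ord.ToType} (hS : #S < κ) : ∃ γ, ∀ s ∈ S, s < γ := by
  have h : ¬ IsCofinal S := fun hc => by
    have := Order.cof_le hc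
    rw [Ordinal.cof_toType, hκ.cof_ord] at this
    exact absurd hS (not_lt.2 this)
  simp only [IsCofinal, not_forall, not_exists, not_and, not_le] at h
  exact h

theorem exists_forall_lt_of_lift_mk_lt {κ : Cardinal.{u}} (hκ : κ.IsRegular) {ι : Type v}
    (hι : Cardinal.lift.{u} #ι < Cardinal.lift.{v} κ) (f : ι → κ.ord.ToType) :
    ∃ γ, ∀ i, f i < γ := by
  have h : #(range f) < κ := by
    have := (Cardinal.mk_range_le_lift (f := f)).trans_lt hι
    simpa using this
  obtain ⟨γ, hγ⟩ := exists_forall_lt_of_mk_lt hκ h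
  exact ⟨γ, fun i => hγ _ ⟨i, rfl⟩⟩

theorem exists_forall_lt_of_countable {κ : Cardinal.{u}} (hκ : κ.IsRegular) (h1 : ℵ₀ < κ)
    {ι : Type v} [Countable ι] (f : ι → κ.ord.ToType) : ∃ γ, ∀ i, f i < γ := by
  refine exists_forall_lt_of_lift_mk_lt hκ ?_ f
  refine (Cardinal.lift_le.2 (Cardinal.mk_le_aleph0 (α := ι))).trans_lt ?_
  rw [Cardinal.lift_aleph0, ← Cardinal.lift_aleph0.{v, u}]
  exact Cardinal.lift_lt.2 h1

theorem mk_Iio_toType_lt {κ : Cardinal.{u}} (i : κ.ord.ToType) : #(Iio i) < κ := by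
  simpa using Cardinal.mk_Iio_lt i (by simp)

theorem mk_Iic_toType_lt {κ : Cardinal.{u}} (hκ : ℵ₀ ≤ κ) (i : κ.ord.ToType) :
    #(Iic i) < κ := by
  have := Cardinal.noMaxOrder hκ
  obtain ⟨j, hj⟩ := exists_gt i
  exact (Cardinal.mk_le_mk_of_subset fun x hx => lt_of_le_of_lt hx hj).trans_lt
    (mk_Iio_toType_lt j)

theorem nonempty_toType_of_isRegular {κ : Cardinal.{u}} (hκ : κ.IsRegular) :
    Nonempty κ.ord.ToType := Cardinal.nonempty_ord_toType hκ.ne_zero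

/-! ### Radially closed sets and pseudoradial spaces -/

/-- Radially closed sets contain limits of sequences indexed by a type of regular cardinality,
in an arbitrary universe. -/
theorem IsRadiallyClosed.mem_of_mk_lt {X : Type u} [TopologicalSpace X] {A : Set X}
    (hA : IsRadiallyClosed A) {ι : Type v} (hι : (#ι).IsRegular) {s : ι → X}
    (hs : ∀ i, s i ∈ A) {x : X} (hx : ∀ U ∈ 𝓝 x, #{i | s i ∉ U} < #ι) : x ∈ A := by
  by_cases hc : Cardinal.lift.{u} #ι ≤ Cardinal.lift.{v} (max #X ℵ₀)
  · obtain ⟨κ, hκ⟩ := Cardinal.mem_range_lift_of_le hc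
    have hreg : κ.IsRegular := by
      rw [← Cardinal.isRegular_lift_iff.{v}, hκ]
      exact Cardinal.isRegular_lift_iff.2 hι
    have hκ' : Cardinal.lift.{v} #κ.ord.ToType = Cardinal.lift.{u} #ι := by simpa using hκ
    obtain ⟨e⟩ := Cardinal.lift_mk_eq'.1 hκ'
    refine hA κ hreg (s ∘ e) (fun α => hs _) x fun U hU => ?_
    have h1 := hx U hU
    rw [← Cardinal.lift_lt.{u, v}, hκ]
    refine lt_of_eq_of_lt ?_ (Cardinal.lift_lt.{v, u}.2 h1)
    refine Cardinal.lift_mk_eq'.2 ⟨(e.subtypeEquiv fun a => ?_)⟩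
    simp
  · push Not at hc
    have hc1 : Cardinal.lift.{u} #ι > Cardinal.lift.{v} #X :=
      (Cardinal.lift_le.2 (le_max_left _ _)).trans_lt hc
    obtain ⟨y, hy⟩ : ∃ y, #(s ⁻¹' {y}) = #ι := by
      have h := Cardinal.infinite_pigeonhole (fun i : ULift.{u} ι => (ULift.up.{v} (s i.down)))
        (by simpa using hι.aleph0_le)
        (by
          have h2 : (Cardinal.lift.{u} #ι).IsRegular := Cardinal.isRegular_lift_iff.2 hι
          simpa [h2.cof_ord] using hc1)
      obtain ⟨y, hy⟩ := h
      refine ⟨y.down, ?_⟩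
      have h3 : Cardinal.lift.{u} #(s ⁻¹' {y.down}) = Cardinal.lift.{u} #ι := by
        rw [← Cardinal.mk_uLift, ← Cardinal.mk_uLift, ← hy]
        refine Cardinal.mk_congr ?_
        refine Equiv.ulift.trans (Equiv.ulift.symm.subtypeEquiv fun a => ?_)
        cases y
        simp [ULift.ext_iff]
      exact Cardinal.lift_injective h3
    have hyA : y ∈ A := by
      have : Nonempty (s ⁻¹' {y}) := by
        rw [← Cardinal.mk_ne_zero_iff, hy]
        exact hι.ne_zero
      obtain ⟨i, hi⟩ := this
      exact hi ▸ hs i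
    refine hA ℵ₀ Cardinal.isRegular_aleph0 (fun _ => y) (fun _ => hyA) x fun U hU => ?_
    have hyU : y ∈ U := by
      by_contra hyU
      refine absurd (hx U hU) (not_lt.2 (hy.ge.trans (Cardinal.mk_le_mk_of_subset ?_)))
      intro i hi
      have : s i = y := hi
      simpa [this] using hyU
    simp [hyU, Cardinal.aleph0_pos]

theorem IsRadiallyClosed.mem_of_tendsto {X : Type u} [TopologicalSpace X] {A : Set X}
    (hA : IsRadiallyClosed A) {κ : Cardinal.{v}} (hκ : κ.IsRegular) {s : κ.ord.ToType → X}
    (hs : ∀ i, s i ∈ A) {x : X} (hx : Tendsto s atTop (𝓝 x)) : x ∈ A := by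
  have := nonempty_toType_of_isRegular hκ
  refine hA.mem_of_mk_lt (by simpa using hκ) hs fun U hU => ?_
  obtain ⟨a, ha⟩ := mem_atTop_sets.1 (hx hU)
  rw [Cardinal.mk_ord_toType]
  refine (Cardinal.mk_le_mk_of_subset ?_).trans_lt (mk_Iio_toType_lt a)
  intro i hi
  by_contra h
  exact hi (ha i (not_lt.1 h))

theorem isPseudoradial_iff {X : Type u} [TopologicalSpace X] :
    IsPseudoradial X ↔ ∀ A : Set X, IsRadiallyClosed A → IsClosed A := by
  constructor
  · intro h A hA
    have : radialClosure A = A :=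
      ((isLeast_radialClosure A).2 ⟨hA, subset_rfl⟩).antisymm (isLeast_radialClosure A).1.2
    exact this ▸ h A
  · intro h A
    exact h _ (isLeast_radialClosure A).1.1

theorem IsWeaklyPseudoradial.closure_subset {X : Type u} [TopologicalSpace X]
    (h : IsWeaklyPseudoradial X) {A : Set X} (hA : IsRadiallyClosed A) {C : Set X}
    (hC : C.Countable) (hCA : C ⊆ A) : closure C ⊆ A :=
  (closure_minimal (isLeast_radialClosure C).1.2 (h C hC)).trans
    ((isLeast_radialClosure C).2 ⟨hA, hCA⟩)

theorem IsRadiallyClosed.preimage {X : Type u} {Y : Type v} [TopologicalSpace X]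
    [TopologicalSpace Y] {A : Set Y} (hA : IsRadiallyClosed A) {f : X → Y} (hf : Continuous f) :
    IsRadiallyClosed (f ⁻¹' A) := by
  intro κ hκ s hs x hx
  refine hA.mem_of_mk_lt (ι := κ.ord.ToType) (by simpa using hκ) (s := f ∘ s) hs
    fun U hU => ?_
  simpa using hx _ (hf.continuousAt hU)

theorem IsPseudoradial.of_surjective {X : Type u} {Y : Type v} [TopologicalSpace X]
    [TopologicalSpace Y] [CompactSpace X] [T2Space Y] (hX : IsPseudoradial X) {f : X → Y}
    (hf : Continuous f) (hsurj : Function.Surjective f) : IsPseudoradial Y := by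
  rw [isPseudoradial_iff] at hX ⊢
  intro A hA
  rw [← image_preimage_eq A hsurj]
  exact hf.isClosedMap _ (hX _ (hA.preimage hf))

theorem IsPseudoradial.subtype {X : Type u} [TopologicalSpace X] (hX : IsPseudoradial X)
    {F : Set X} (hF : IsClosed F) : IsPseudoradial F := by
  rw [isPseudoradial_iff] at hX ⊢
  intro A hA
  have h : IsRadiallyClosed (Subtype.val '' A) := by
    intro κ hκ s hs x hx
    choose t ht hts using hs
    have hxF : x ∈ F := by
      by_contra hxF
      have h1 := hx Fᶜ (hF.isOpen_compl.mem_nhds hxF)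
      have : {α | s α ∉ Fᶜ} = Set.univ := by
        ext α
        simp [← hts]
      rw [this, Cardinal.mk_univ, Cardinal.mk_ord_toType] at h1
      exact lt_irrefl _ h1
    refine ⟨⟨x, hxF⟩, hA κ hκ t ht _ fun U hU => ?_, rfl⟩
    obtain ⟨V, hV, hVU⟩ := mem_nhds_subtype F ⟨x, hxF⟩ U |>.1 hU
    refine (Cardinal.mk_le_mk_of_subset ?_).trans_lt (hx V hV)
    intro α hα hαV
    refine hα (hVU ?_)
    simpa [hts] using hαV
  have := (hX _ h).preimage (continuous_subtype_val (p := (· ∈ F)))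
  rwa [preimage_image_eq _ Subtype.val_injective] at this

/-! ### Independent families of closed sets -/

/-- There is no family of `ℵ₂` pairs of disjoint closed sets all of whose finite mixed
intersections are nonempty; for compact spaces: no closed subspace maps onto `2 ^ ℵ₂`. -/
def NoIndependentFamily (Z : Type u) [TopologicalSpace Z] : Prop :=
  ∀ (T : Type u), #T = ℵ_ 2 → ∀ C : T → Bool → Set Z, (∀ t b, IsClosed (C t b)) →
    (∀ t, Disjoint (C t true) (C t false)) →
    ∃ (s : Finset T) (b : T → Bool), ⋂ t ∈ s, C t (b t) = ∅

theorem NoIndependentFamily.subtype {Z : Type u} [TopologicalSpace Z]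
    (hZ : NoIndependentFamily Z) {F : Set Z} (hF : IsClosed F) : NoIndependentFamily F := by
  intro T hT C hC hd
  have : Nonempty T := by
    rw [← Cardinal.mk_ne_zero_iff, hT]
    exact (Cardinal.aleph_pos _).ne'
  classical
  obtain ⟨s, b, h⟩ := hZ T hT (fun t b => Subtype.val '' C t b)
    (fun t b => hF.isClosedEmbedding_subtypeVal.isClosedMap _ (hC t b))
    (fun t => (disjoint_image_iff Subtype.val_injective).2 (hd t))
  obtain ⟨t₀⟩ := this
  refine ⟨insert t₀ s, b, ?_⟩
  rw [eq_empty_iff_forall_notMem] at h ⊢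
  intro x hx
  refine h x.1 ?_
  simp only [mem_iInter] at hx ⊢
  exact fun t ht => ⟨x, hx t (by simp [ht]), rfl⟩

/-- An independent family on a compact space yields a closed subset that maps onto the cube. -/
theorem exists_surjective_of_independent {Z : Type u} [TopologicalSpace Z] [CompactSpace Z]
    {T : Type v} {C : T → Bool → Set Z} (hC : ∀ t b, IsClosed (C t b))
    (hd : ∀ t, Disjoint (C t true) (C t false))
    (hne : ∀ (s : Finset T) (b : T → Bool), (⋂ t ∈ s, C t (b t)).Nonempty) :
    ∃ (F : Set Z) (f : F → T → Bool), IsClosed F ∧ Continuous f ∧ Function.Surjective f ∧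
      ∀ x t, x.1 ∈ C t (f x t) := by
  classical
  set F : Set Z := ⋂ t, C t true ∪ C t false with hF
  let f : F → T → Bool := fun x t => decide (x.1 ∈ C t true)
  have hfC : ∀ x t, x.1 ∈ C t (f x t) := by
    intro x t
    by_cases h : x.1 ∈ C t true
    · simp [f, h]
    · have := mem_iInter.1 x.2 t
      simpa [f, h] using this
  have hfu : ∀ x t b, x.1 ∈ C t b → f x t = b := by
    intro x t b hb
    have h1 := hfC x t
    cases h2 : f x t <;> cases b <;> try rfl
    · rw [h2] at h1
      exact ((hd t).ne_of_mem hb h1 rfl).elim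
    · rw [h2] at h1
      exact ((hd t).ne_of_mem h1 hb rfl).elim
  refine ⟨F, f, isClosed_iInter fun t => (hC t _).union (hC t _), ?_, ?_, hfC⟩
  · refine continuous_pi fun t => ?_
    refine continuous_iff_isClosed.2 fun S hS => ?_
    have : (fun x => f x t) ⁻¹' S = ⋃ b ∈ S, Subtype.val ⁻¹' C t b := by
      ext x
      simp only [mem_preimage, mem_iUnion, exists_prop]
      exact ⟨fun h => ⟨_, h, hfC x t⟩, fun ⟨b, hb, h⟩ => hfu x t b h ▸ hb⟩
    rw [this]
    exact (toFinite S).isClosed_biUnion fun b _ => (hC t b).preimage continuous_subtype_val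
  · intro b
    have : (⋂ t, C t (b t)).Nonempty :=
      CompactSpace.iInter_nonempty (fun t => hC t _) fun s => hne s b
    obtain ⟨x, hx⟩ := this
    rw [mem_iInter] at hx
    have hxF : x ∈ F := by
      refine mem_iInter.2 fun t => ?_
      have := hx t
      cases h : b t <;> rw [h] at this
      exacts [Or.inr this, Or.inl this]
    exact ⟨⟨x, hxF⟩, funext fun t => hfu ⟨x, hxF⟩ t _ (hx t)⟩

theorem IsPseudoradial.noIndependentFamily (hpse : pseudoradialNumber ≤ ℵ_ 2) {X : Type u}
    [TopologicalSpace X] [CompactSpace X] (hX : IsPseudoradial X) : NoIndependentFamily X := by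
  intro T hT C hC hd
  by_contra! hne
  obtain ⟨F, f, hF, hf, hfs, -⟩ := exists_surjective_of_independent hC hd
    fun s b => hne s b
  have : CompactSpace F := isCompact_iff_compactSpace.1 hF.isCompact
  have h : Cardinal.lift.{u} #pseudoradialNumber.out ≤ Cardinal.lift.{0} #T := by
    rw [Cardinal.mk_out, hT]
    have := Cardinal.lift_le.{u}.2 hpse
    simpa using this
  obtain ⟨e⟩ := Cardinal.lift_mk_le'.1 h
  refine pseudoradialNumber_spec ((hX.subtype hF).of_surjective
    (f := fun x i => f x (e i)) ?_ ?_)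
  · exact continuous_pi fun i => (continuous_apply (e i)).comp hf
  · intro y
    obtain ⟨x, hx⟩ := hfs (Function.extend e y fun _ => false)
    exact ⟨x, funext fun i => by simp [hx, e.injective.extend_apply]⟩

/-! ### Finite partial functions -/

/-- A finite set of pairs is consistent if it is the graph of a partial function to `Bool`. -/
def IsConsistent {Ω : Type u} (τ : Finset (Ω × Bool)) : Prop :=
  ∀ i b c, (i, b) ∈ τ → (i, c) ∈ τ → b = c

theorem IsConsistent.mono {Ω : Type u} {τ τ' : Finset (Ω × Bool)} (h : IsConsistent τ')
    (hs : τ ⊆ τ') : IsConsistent τ :=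
  fun i b c hb hc => h i b c (hs hb) (hs hc)

/-- Every other member contradicts a fixed `a ∈ 𝓐`, so it contains the flip of one of the finitely
many pairs in `a`. Members sharing such a pair stay pairwise inconsistent once it is erased, and
induction on the size applies. -/
theorem finite_of_pairwise_not_isConsistent {Ω : Type u} [DecidableEq Ω] (n : ℕ) :
    ∀ 𝓐 : Set (Finset (Ω × Bool)), (∀ τ ∈ 𝓐, IsConsistent τ ∧ τ.card ≤ n) →
      (𝓐.Pairwise fun τ τ' => ¬ IsConsistent (τ ∪ τ')) → 𝓐.Finite := by
  induction n with
  | zero =>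
    intro 𝓐 h _
    refine (finite_singleton (∅ : Finset (Ω × Bool))).subset fun τ hτ => ?_
    simpa using (h τ hτ).2
  | succ n ih =>
    intro 𝓐 h hp
    rcases 𝓐.eq_empty_or_nonempty with rfl | ⟨a, ha⟩
    · exact finite_empty
    have hcov : 𝓐 ⊆ {a} ∪ ⋃ e ∈ a, {τ ∈ 𝓐 | (e.1, !e.2) ∈ τ} := by
      intro τ hτ
      by_cases hne : τ = a
      · exact Or.inl hne
      right
      have hc := hp ha hτ (Ne.symm hne)
      simp only [IsConsistent, not_forall] at hc
      obtain ⟨i, b, c, hb, hc, hbc⟩ := hc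
      have hcb : c = !b := Bool.eq_not.2 (Ne.symm hbc)
      have hbc' : b = !c := Bool.eq_not.2 hbc
      rw [Finset.mem_union] at hb hc
      simp only [mem_iUnion, exists_prop]
      rcases hb with hb | hb <;> rcases hc with hc | hc
      · exact (hbc ((h a ha).1 i b c hb hc)).elim
      · exact ⟨(i, b), hb, hτ, by simpa [← hcb] using hc⟩
      · exact ⟨(i, c), hc, hτ, by simpa [← hbc'] using hb⟩
      · exact (hbc ((h τ hτ).1 i b c hb hc)).elim
    refine (Finite.union (finite_singleton a) (a.finite_toSet.biUnion fun e _ => ?_)).subset hcov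
    generalize he : (e.1, !e.2) = e'
    have hinj : InjOn (fun τ : Finset (Ω × Bool) => τ.erase e') {τ ∈ 𝓐 | e' ∈ τ} := by
      intro τ hτ τ' hτ' heq
      have : insert e' (τ.erase e') = insert e' (τ'.erase e') := congrArg _ heq
      rwa [Finset.insert_erase hτ.2, Finset.insert_erase hτ'.2] at this
    refine Finite.of_finite_image (f := fun τ => τ.erase e') (ih _ ?_ ?_) hinj
    · rintro _ ⟨τ, hτ, rfl⟩
      refine ⟨(h τ hτ.1).1.mono (Finset.erase_subset _ _), ?_⟩
      have := (h τ hτ.1).2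
      rw [Finset.card_erase_of_mem hτ.2]
      omega
    · rintro _ ⟨τ, hτ, rfl⟩ _ ⟨τ', hτ', rfl⟩ hne hcons
      refine hp hτ.1 hτ'.1 (fun h => hne (by rw [h])) ?_
      have key : ∀ i b c, (i, b) = e' → (i, c) ∈ τ ∪ τ' → b = c := by
        intro i b c hb hc
        rcases Finset.mem_union.1 hc with hc | hc
        · exact (h τ hτ.1).1 i b c (hb ▸ hτ.2) hc
        · exact (h τ' hτ'.1).1 i b c (hb ▸ hτ'.2) hc
      intro i b c hb hc
      by_cases h1 : (i, b) = e'
      · exact key i b c h1 hc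
      by_cases h2 : (i, c) = e'
      · exact (key i c b h2 hb).symm
      refine hcons i b c ?_ ?_
      · simpa [h1] using hb
      · simpa [h2] using hc

theorem countable_of_pairwise_not_isConsistent {Ω : Type u} [DecidableEq Ω]
    {𝓐 : Set (Finset (Ω × Bool))} (h : ∀ τ ∈ 𝓐, IsConsistent τ)
    (hp : 𝓐.Pairwise fun τ τ' => ¬ IsConsistent (τ ∪ τ')) : 𝓐.Countable := by
  have : 𝓐 = ⋃ n : ℕ, {τ ∈ 𝓐 | τ.card ≤ n} := by
    ext τ
    simp only [mem_iUnion, mem_sep_iff, exists_and_left]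
    exact ⟨fun h => ⟨h, _, le_rfl⟩, fun h => h.1⟩
  rw [this]
  exact countable_iUnion fun n => (finite_of_pairwise_not_isConsistent n _
    (fun τ hτ => ⟨h τ hτ.1, hτ.2⟩) (hp.mono fun τ hτ => hτ.1)).countable

/-! ### Transfinite recursion -/

/-- Transfinite recursion for a condition that depends only on the values up to `ξ`; the default
value used beyond `ξ` is therefore harmless. -/
theorem exists_forall_of_forall_exists_update {ι : Type u} [LinearOrder ι] [WellFoundedLT ι]
    {δ : Type v} [Nonempty δ] (Φ : ι → (ι → δ) → Prop)
    (hloc : ∀ ξ D D', (∀ ζ ≤ ξ, D ζ = D' ζ) → Φ ξ D → Φ ξ D')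
    (hext : ∀ ξ D, (∀ ζ < ξ, Φ ζ D) → ∃ d, Φ ξ (Function.update D ξ d)) :
    ∃ D, ∀ ξ, Φ ξ D := by
  classical
  let d₀ : δ := Classical.arbitrary δ
  let ext : (ξ : ι) → ((ζ : ι) → ζ < ξ → δ) → ι → δ :=
    fun ξ prev ζ => if h : ζ < ξ then prev ζ h else d₀
  let step : (ξ : ι) → ((ζ : ι) → ζ < ξ → δ) → δ := fun ξ prev =>
    if h : ∃ d, Φ ξ (Function.update (ext ξ prev) ξ d) then h.choose else d₀
  let D : ι → δ := wellFounded_lt.fix step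
  have hD : ∀ ξ, D ξ = step ξ fun ζ _ => D ζ := fun ξ => wellFounded_lt.fix_eq step ξ
  refine ⟨D, fun ξ => ?_⟩
  induction ξ using WellFoundedLT.induction with
  | ind ξ ih =>
    have hagree : ∀ ζ < ξ, ext ξ (fun ζ _ => D ζ) ζ = D ζ := fun ζ hζ => by simp [ext, hζ]
    have hex : ∃ d, Φ ξ (Function.update (ext ξ fun ζ _ => D ζ) ξ d) :=
      hext ξ _ fun ζ hζ => hloc ζ D _ (fun η hη => (hagree η (hη.trans_lt hζ)).symm) (ih ζ hζ)
    have h1 : D ξ = hex.choose := by rw [hD]; simp only [step, dif_pos hex]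
    refine hloc ξ _ D (fun ζ hζ => ?_) hex.choose_spec
    rcases hζ.lt_or_eq with h | rfl
    · rw [Function.update_of_ne h.ne, hagree ζ h]
    · rw [Function.update_self, h1]

/-! ### Systems of pairs of open sets -/

section Systems

variable {H : Type u} {Ω : Type u}

/-- `τ` is admissible if it is a finite partial function that contains the support `(D i).2` of
each index `i` at which it is defined. -/
def IsAdmissible (D : Ω → (Bool → Set H) × Finset (Ω × Bool)) (τ : Finset (Ω × Bool)) : Prop :=
  IsConsistent τ ∧ ∀ p ∈ τ, (D p.1).2 ⊆ τ

/-- The intersection of the sets selected by `τ`. -/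
def cell (D : Ω → (Bool → Set H) × Finset (Ω × Bool)) (τ : Finset (Ω × Bool)) : Set H :=
  ⋂ p ∈ τ, (D p.1).1 p.2

/-- At stage `ξ` the system `D` has a pair of open sets with disjoint closures, each of which
meets all cells over earlier indices that extend the support of `ξ`. -/
structure IsStage [TopologicalSpace H] [LinearOrder Ω]
    (D : Ω → (Bool → Set H) × Finset (Ω × Bool)) (ξ : Ω) : Prop where
  isOpen : ∀ b, IsOpen ((D ξ).1 b)
  disjoint : Disjoint (closure ((D ξ).1 true)) (closure ((D ξ).1 false))
  lt : ∀ p ∈ (D ξ).2, p.1 < ξ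
  admissible : IsAdmissible D (D ξ).2
  nonempty : ∀ τ, IsAdmissible D τ → (∀ p ∈ τ, p.1 < ξ) → (D ξ).2 ⊆ τ →
    ∀ b, (cell D τ ∩ (D ξ).1 b).Nonempty

variable {D D' : Ω → (Bool → Set H) × Finset (Ω × Bool)} {ξ : Ω} {τ τ' : Finset (Ω × Bool)}

theorem IsAdmissible.congr [LinearOrder Ω]
    (h : ∀ ζ < ξ, D ζ = D' ζ) (hτ : ∀ p ∈ τ, p.1 < ξ)
    (ha : IsAdmissible D τ) : IsAdmissible D' τ :=
  ⟨ha.1, fun p hp => h p.1 (hτ p hp) ▸ ha.2 p hp⟩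

theorem IsAdmissible.union [DecidableEq Ω] (h : IsAdmissible D τ) (h' : IsAdmissible D τ')
    (hc : IsConsistent (τ ∪ τ')) : IsAdmissible D (τ ∪ τ') := by
  refine ⟨hc, fun p hp => ?_⟩
  rcases Finset.mem_union.1 hp with hp | hp
  · exact (h.2 p hp).trans Finset.subset_union_left
  · exact (h'.2 p hp).trans Finset.subset_union_right

theorem isAdmissible_empty : IsAdmissible D ∅ := by
  constructor <;> simp [IsConsistent]

theorem cell_anti (h : τ ⊆ τ') : cell D τ' ⊆ cell D τ :=
  biInter_subset_biInter_left h

theorem cell_congr [LinearOrder Ω]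
    (h : ∀ ζ < ξ, D ζ = D' ζ) (hτ : ∀ p ∈ τ, p.1 < ξ) : cell D τ = cell D' τ :=
  iInter₂_congr fun p hp => by rw [h p.1 (hτ p hp)]

theorem isOpen_cell [TopologicalSpace H] [LinearOrder Ω]
    (h : ∀ p ∈ τ, IsStage D p.1) : IsOpen (cell D τ) :=
  isOpen_biInter_finset fun p hp => (h p hp).isOpen _

theorem IsStage.congr [TopologicalSpace H] [LinearOrder Ω]
    (h : ∀ ζ ≤ ξ, D ζ = D' ζ) (hD : IsStage D ξ) : IsStage D' ξ := by
  have hlt : ∀ ζ < ξ, D ζ = D' ζ := fun ζ hζ => h ζ hζ.le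
  have hξ := h ξ le_rfl
  refine ⟨hξ ▸ hD.isOpen, hξ ▸ hD.disjoint, hξ ▸ hD.lt, ?_, ?_⟩
  · exact hξ ▸ hD.admissible.congr hlt hD.lt
  · intro τ hτ hτξ hs b
    rw [← hξ] at hs ⊢
    rw [← cell_congr hlt hτξ]
    exact hD.nonempty τ (hτ.congr (fun ζ hζ => (hlt ζ hζ).symm) hτξ) hτξ hs b

/-- Remove the pair with the largest index. Supports contain only smaller indices, so the rest is
still admissible, and the stage at the removed index meets its cell. -/
theorem cell_nonempty [TopologicalSpace H] [LinearOrder Ω]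
    [Nonempty H] (hτ : IsAdmissible D τ) (h : ∀ p ∈ τ, IsStage D p.1) :
    (cell D τ).Nonempty := by
  rcases τ.eq_empty_or_nonempty with rfl | hne
  · simp [cell]
  obtain ⟨p, hp, hmax⟩ := τ.exists_max_image Prod.fst hne
  have hsub : ∀ q ∈ τ, (D q.1).2 ⊆ τ.erase p := by
    intro q hq r hr
    refine Finset.mem_erase.2 ⟨?_, hτ.2 q hq hr⟩
    rintro rfl
    exact absurd ((h q hq).lt _ hr) (not_lt.2 (hmax q hq))
  have hadm : IsAdmissible D (τ.erase p) :=
    ⟨hτ.1.mono (Finset.erase_subset _ _), fun q hq => hsub q (Finset.mem_of_mem_erase hq)⟩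
  obtain ⟨x, hx, hxp⟩ := (h p hp).nonempty (τ.erase p) hadm
    (fun q hq => by
      obtain ⟨hqp, hq⟩ := Finset.mem_erase.1 hq
      exact lt_of_le_of_ne (hmax q hq) fun heq => hqp
        (Prod.ext heq (hτ.1 q.1 q.2 p.2 hq (heq ▸ hp))))
    (hsub p hp) p.2
  refine ⟨x, ?_⟩
  rw [cell, ← Finset.insert_erase hp, Finset.set_biInter_insert]
  exact ⟨hxp, hx⟩

/-- As long as the cells contain no local `π`-network at any point, the system can be prolonged:
near a suitable `p`, one side is a small neighbourhood `U p`, the other the complement of `closure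
(V p)`. Every cell meets the latter, since none lies in `W p`. -/
theorem exists_isStage_update [TopologicalSpace H] [LinearOrder Ω]
    [CompactSpace H] [T2Space H] [Nonempty H]
    (hprev : ∀ ζ < ξ, IsStage D ζ)
    (hno : ∀ p : H, ∃ W ∈ 𝓝 p, ∀ τ, IsAdmissible D τ → (∀ q ∈ τ, q.1 < ξ) → ¬ cell D τ ⊆ W) :
    ∃ d, IsStage (Function.update D ξ d) ξ := by
  have hno' : ∀ p : H, ∃ U V W : Set H, IsOpen U ∧ IsOpen V ∧ p ∈ U ∧ closure U ⊆ V ∧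
      closure V ⊆ W ∧
      ∀ τ, IsAdmissible D τ → (∀ q ∈ τ, q.1 < ξ) → ¬ cell D τ ⊆ W := by
    intro p
    obtain ⟨W, hW, h⟩ := hno p
    obtain ⟨V, hVp, hVc, hVW⟩ := exists_mem_nhds_isClosed_subset hW
    obtain ⟨U, hUp, hUc, hUV⟩ := exists_mem_nhds_isClosed_subset (isOpen_interior.mem_nhds
      (mem_interior_iff_mem_nhds.2 hVp))
    exact ⟨interior U, interior V, W, isOpen_interior, isOpen_interior,
      mem_interior_iff_mem_nhds.2 hUp,
      (closure_minimal interior_subset hUc).trans hUV,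
      (closure_minimal interior_subset hVc).trans hVW, h⟩
  choose U V W hU hV hpU hUV hVW hW using hno'
  obtain ⟨t, ht⟩ := isCompact_univ.elim_finite_subcover U hU
    (fun p _ => mem_iUnion.2 ⟨p, hpU p⟩)
  classical
  -- Otherwise every admissible `σ` extends to one whose cell misses a prescribed `U p`. Doing this
  -- for each member of the finite cover gives a nonempty cell that misses the whole space.
  have hex : ∃ σ p, IsAdmissible D σ ∧ (∀ q ∈ σ, q.1 < ξ) ∧
      ∀ τ, IsAdmissible D τ → (∀ q ∈ τ, q.1 < ξ) → σ ⊆ τ → (cell D τ ∩ U p).Nonempty := by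
    by_contra! hcon
    have hfin : ∀ s : Finset H, ∃ τ, IsAdmissible D τ ∧ (∀ q ∈ τ, q.1 < ξ) ∧
        ∀ p ∈ s, cell D τ ∩ U p = ∅ := by
      intro s
      induction s using Finset.induction_on with
      | empty => exact ⟨∅, isAdmissible_empty, by simp, by simp⟩
      | insert p s _ ih =>
        obtain ⟨σ, hσ, hσξ, hs⟩ := ih
        obtain ⟨τ, hτ, hτξ, hστ, h⟩ := hcon σ p hσ hσξ
        refine ⟨τ, hτ, hτξ, fun q hq => ?_⟩
        rcases Finset.mem_insert.1 hq with rfl | hq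
        · exact h
        · exact subset_empty_iff.1 ((inter_subset_inter_left _ (cell_anti hστ)).trans
            (hs q hq).subset)
    obtain ⟨τ, hτ, hτξ, h⟩ := hfin t
    obtain ⟨x, hx⟩ := cell_nonempty hτ fun p hp => hprev _ (hτξ p hp)
    obtain ⟨p, hp, hxp⟩ := mem_iUnion₂.1 (ht (mem_univ x))
    exact (h p hp).subset ⟨hx, hxp⟩
  obtain ⟨σ, p, hσ, hσξ, h⟩ := hex
  let d : (Bool → Set H) × Finset (Ω × Bool) := (fun b => cond b (U p) (closure (V p))ᶜ, σ)
  have hlt : ∀ ζ < ξ, D ζ = Function.update D ξ d ζ := fun ζ hζ => by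
    rw [Function.update_of_ne hζ.ne]
  refine ⟨d, ?_⟩
  constructor
  · intro b
    cases b <;> simp [d, hU p]
  · simp only [Function.update_self, d, cond_true, cond_false]
    refine Disjoint.mono_left (hUV p) ?_
    refine Disjoint.closure_right ?_ (hV p)
    exact disjoint_compl_right.mono_left subset_closure
  · simpa [d] using hσξ
  · simpa [d] using hσ.congr hlt hσξ
  · intro τ hτ hτξ hs b
    simp only [Function.update_self, d] at hs
    rw [← cell_congr hlt hτξ, Function.update_self]
    have hτ' := hτ.congr (fun ζ hζ => (hlt ζ hζ).symm) hτξ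
    cases b
    · obtain ⟨x, hx, hxW⟩ := not_subset.1 (hW p τ hτ' hτξ)
      exact ⟨x, hx, fun hxV => hxW (hVW p hxV)⟩
    · exact h τ hτ' hτξ hs

end Systems

/-! ### Pressing down on `ω₂` and the termination of the recursion -/

theorem isRegular_aleph_two : (ℵ_ 2 : Cardinal.{u}).IsRegular := by
  have := Cardinal.isRegular_aleph_add_one.{u} 1
  rwa [one_add_one_eq_two] at this

theorem lt_aleph_two_iff {c : Cardinal.{u}} : c < ℵ_ 2 ↔ c ≤ ℵ₁ := by
  have h : (ℵ_ 2 : Cardinal.{u}) = Order.succ ℵ₁ := by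
    rw [← one_add_one_eq_two, ← Cardinal.succ_aleph]
  rw [h, Order.lt_succ_iff]

theorem aleph0_lt_aleph_two : (ℵ₀ : Cardinal.{u}) < ℵ_ 2 :=
  lt_aleph_two_iff.2 Cardinal.aleph0_lt_aleph_one.le

theorem mk_finset_prod_bool_lt {α : Type u} {c : Cardinal.{u}} (hc : ℵ₀ < c) (h : #α < c) :
    #(Finset (α × Bool)) < c := by
  cases finite_or_infinite α
  · exact (Cardinal.lt_aleph0_of_finite _).trans hc
  · rw [Cardinal.mk_finset_of_infinite, Cardinal.mk_prod]
    refine Cardinal.mul_lt_of_lt hc.le (by simpa using h) ?_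
    exact (by simpa using (Cardinal.natCast_lt_aleph0 (n := 2)).trans hc)

/-- A regressive assignment of finite sets on `ω₂` is constant on a set of size `ℵ₂`. -/
theorem exists_mk_fiber_eq_aleph_two
    (S : (ℵ_ 2 : Cardinal.{u}).ord.ToType → Finset ((ℵ_ 2 : Cardinal.{u}).ord.ToType × Bool))
    (hS : ∀ ξ, ∀ p ∈ S ξ, p.1 < ξ) : ∃ σ, #{ξ | S ξ = σ} = ℵ_ 2 := by
  classical
  by_contra! hne
  have hlt : ∀ σ, #{ξ | S ξ = σ} < ℵ_ 2 := fun σ =>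
    lt_of_le_of_ne (by simpa using Cardinal.mk_set_le {ξ | S ξ = σ}) (hne σ)
  choose g hg using fun σ => exists_forall_lt_of_mk_lt isRegular_aleph_two (hlt σ)
  have hnext : ∀ δ, ∃ δ', δ < δ' ∧ ∀ σ : Finset _, (∀ p ∈ σ, p.1 < δ) → g σ < δ' := by
    intro δ
    obtain ⟨γ, hγ⟩ := exists_forall_lt_of_lift_mk_lt isRegular_aleph_two
      (ι := Finset (Iio δ × Bool))
      (Cardinal.lift_lt.2 (mk_finset_prod_bool_lt aleph0_lt_aleph_two (mk_Iio_toType_lt δ)))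
      fun t => g (t.image (Prod.map Subtype.val id))
    have := Cardinal.noMaxOrder (isRegular_aleph_two.{u}).aleph0_le
    obtain ⟨δ', hδ'⟩ := exists_gt (max δ γ)
    refine ⟨δ', (le_max_left _ _).trans_lt hδ', fun σ hσ => ?_⟩
    have : σ = (σ.attach.image fun p => ((⟨p.1.1, hσ _ p.2⟩ : Iio δ), p.1.2)).image
        (Prod.map Subtype.val id) := by
      ext ⟨i, b⟩
      refine ⟨fun h => Finset.mem_image.2 ⟨(⟨i, hσ _ h⟩, b),
        Finset.mem_image.2 ⟨⟨(i, b), h⟩, Finset.mem_attach _ _, rfl⟩, rfl⟩, fun h => ?_⟩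
      obtain ⟨_, h1, h2⟩ := Finset.mem_image.1 h
      obtain ⟨⟨q, hq⟩, -, rfl⟩ := Finset.mem_image.1 h1
      exact h2 ▸ hq
    rw [this]
    exact (hγ _).trans ((le_max_right _ _).trans_lt hδ')
  choose next hnext_lt hnext using hnext
  have : Nonempty (ℵ_ 2 : Cardinal.{u}).ord.ToType :=
    nonempty_toType_of_isRegular isRegular_aleph_two
  let d : ℕ → (ℵ_ 2 : Cardinal.{u}).ord.ToType := fun n => next^[n] (Classical.arbitrary _)
  have hd : ∀ n, d (n + 1) = next (d n) := fun n => Function.iterate_succ_apply' _ _ _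
  have hmono : StrictMono d := strictMono_nat_of_lt_succ fun n => by
    rw [hd]
    exact hnext_lt _
  obtain ⟨γ, hγ⟩ := exists_forall_lt_of_countable isRegular_aleph_two aleph0_lt_aleph_two d
  have hex : {γ | ∀ n, d n ≤ γ}.Nonempty := ⟨γ, fun n => (hγ n).le⟩
  -- `δ` is the supremum of the `d n`. The finite set `S δ` lies below some `d n`, so the bound `g
  -- (S δ)` of its fibre is below `δ`, although `δ` is in that fibre.
  set δ := wellFounded_lt.min _ hex with hδ
  have hδd : ∀ n, d n ≤ δ := wellFounded_lt.min_mem _ hex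
  have hlt_d : ∀ i < δ, ∃ n, i < d n := by
    intro i hi
    by_contra! h
    exact wellFounded_lt.not_lt_min {γ | ∀ n, d n ≤ γ} h hi
  choose! n hn using hlt_d
  have h1 : g (S δ) < d ((S δ).sup (fun p => n p.1) + 1) := by
    rw [hd]
    refine hnext _ _ fun p hp => (hn _ (hS δ p hp)).trans_le (hmono.monotone ?_)
    exact Finset.le_sup (f := fun p => n p.1) hp
  exact lt_irrefl _ (((hg (S δ) δ rfl).trans h1).trans_le (hδd _))

/-- If all stages succeeded, `ℵ₂` many would share one support `σ`. Arbitrary finite choices at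
these indices can be added to `σ` admissibly, since the indices in `σ` are smaller, so the closures
would form an independent family. -/
theorem exists_not_isStage {H : Type u} [TopologicalSpace H] [Nonempty H]
    (hH : NoIndependentFamily H)
    (D : (ℵ_ 2 : Cardinal.{u}).ord.ToType →
      (Bool → Set H) × Finset ((ℵ_ 2 : Cardinal.{u}).ord.ToType × Bool)) :
    ∃ ξ, ¬ IsStage D ξ := by
  classical
  by_contra! hD
  obtain ⟨σ, hσ⟩ := exists_mk_fiber_eq_aleph_two (fun ξ => (D ξ).2) fun ξ => (hD ξ).lt
  obtain ⟨s, b, h⟩ := hH {ξ | (D ξ).2 = σ} hσ (fun ξ b => closure ((D ξ).1 b))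
    (fun _ _ => isClosed_closure) fun ξ => (hD ξ).disjoint
  have hσ' : IsAdmissible D σ := by
    have : Nonempty {ξ | (D ξ).2 = σ} := by
      rw [← Cardinal.mk_ne_zero_iff, hσ]
      exact (Cardinal.aleph_pos _).ne'
    obtain ⟨ξ, rfl⟩ := this
    exact (hD ξ).admissible
  let τ := s.image fun ξ => (ξ.1, b ξ)
  have hτ : IsAdmissible D (σ ∪ τ) := by
    have key : ∀ i c c', (i, c) ∈ σ → (i, c') ∉ τ := by
      intro i c c' hσi hτi
      obtain ⟨ξ, hξs, hξ⟩ := Finset.mem_image.1 hτi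
      have h1 : (D ξ.1).2 = σ := ξ.2
      have h2 : ξ.1 = i := congrArg Prod.fst hξ
      exact lt_irrefl _ (((hD ξ.1).lt (i, c) (by rw [h1]; exact hσi)).trans_eq h2)
    constructor
    · intro i c c' hc hc'
      rcases Finset.mem_union.1 hc with hc | hc <;> rcases Finset.mem_union.1 hc' with hc' | hc'
      · exact hσ'.1 i c c' hc hc'
      · exact (key _ _ _ hc hc').elim
      · exact (key _ _ _ hc' hc).elim
      · obtain ⟨ξ, -, hξ⟩ := Finset.mem_image.1 hc
        obtain ⟨ζ, -, hζ⟩ := Finset.mem_image.1 hc'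
        have : ξ = ζ := Subtype.ext ((congrArg Prod.fst hξ).trans (congrArg Prod.fst hζ).symm)
        subst this
        exact congrArg Prod.snd (hξ.symm.trans hζ)
    · intro p hp
      rcases Finset.mem_union.1 hp with hp | hp
      · exact (hσ'.2 p hp).trans Finset.subset_union_left
      · obtain ⟨ξ, -, rfl⟩ := Finset.mem_image.1 hp
        have h1 : (D ξ.1).2 = σ := ξ.2
        rw [h1]
        exact Finset.subset_union_left
  obtain ⟨x, hx⟩ := cell_nonempty hτ fun p _ => hD p.1
  refine notMem_empty x (h.subset (mem_iInter₂.2 fun ξ hξ => subset_closure ?_))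
  exact mem_iInter₂.1 hx (ξ.1, b ξ)
    (Finset.mem_union_right _ (Finset.mem_image_of_mem _ hξ))

/-- In a compact space without large independent families there is a point with a local
`π`-network of cells of an admissible system over an initial segment of `ω₂`. -/
theorem exists_system_and_point {H : Type u} [TopologicalSpace H] [CompactSpace H] [T2Space H]
    [Nonempty H] (hH : NoIndependentFamily H) :
    ∃ (D : (ℵ_ 2 : Cardinal.{u}).ord.ToType →
        (Bool → Set H) × Finset ((ℵ_ 2 : Cardinal.{u}).ord.ToType × Bool)) (ξ : _) (p : H),
      (∀ ζ < ξ, IsStage D ζ) ∧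
      ∀ W ∈ 𝓝 p, ∃ τ, IsAdmissible D τ ∧ (∀ q ∈ τ, q.1 < ξ) ∧ cell D τ ⊆ W := by
  by_contra! hno
  obtain ⟨D, hD⟩ := exists_forall_of_forall_exists_update
    (fun (ξ : (ℵ_ 2 : Cardinal.{u}).ord.ToType)
      (D : _ → (Bool → Set H) × Finset ((ℵ_ 2 : Cardinal.{u}).ord.ToType × Bool)) => IsStage D ξ)
    (fun ξ D D' h => IsStage.congr h)
    (fun ξ D h => exists_isStage_update h fun p => hno D ξ p h)
  obtain ⟨ξ, hξ⟩ := exists_not_isStage hH D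
  exact hξ (hD ξ)

/-! ### Points traced by `ω₁` many filters -/

/-- A maximal antichain from Zorn's lemma; it is countable by the countable chain condition for
finite partial functions. -/
theorem exists_maximal_inconsistent {Ω : Type u} [DecidableEq Ω] (E : Set (Finset (Ω × Bool)))
    (hE : ∀ τ ∈ E, IsConsistent τ) :
    ∃ 𝓐 ⊆ E, 𝓐.Countable ∧ ∀ τ ∈ E, ∃ a ∈ 𝓐, IsConsistent (τ ∪ a) := by
  obtain ⟨𝓐, h𝓐⟩ := zorn_subset
    {𝓐 : Set (Finset (Ω × Bool)) | 𝓐 ⊆ E ∧ 𝓐.Pairwise fun τ τ' => ¬ IsConsistent (τ ∪ τ')}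
    (fun c hc hchain => ⟨⋃₀ c, ⟨sUnion_subset fun s hs => (hc hs).1,
      (pairwise_sUnion hchain.directedOn).2 fun s hs => (hc hs).2⟩,
      fun s hs => subset_sUnion_of_mem hs⟩)
  refine ⟨𝓐, h𝓐.prop.1,
    countable_of_pairwise_not_isConsistent (fun τ hτ => hE τ (h𝓐.prop.1 hτ)) h𝓐.prop.2, ?_⟩
  intro τ hτ
  by_contra! hcon
  have hmem : τ ∈ 𝓐 := by
    refine h𝓐.le_of_ge (y := insert τ 𝓐) ⟨insert_subset hτ h𝓐.prop.1, ?_⟩ (subset_insert _ _)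
      (mem_insert _ _)
    refine h𝓐.prop.2.insert fun a ha _ => ⟨hcon a ha, ?_⟩
    rw [Finset.union_comm]
    exact hcon a ha
  have := hcon τ hmem
  rw [Finset.union_self] at this
  exact this (hE τ hτ)

/-- A form of Šapirovskiĭ's theorem: a nonempty compact space without independent families of
size `ℵ₂` has a point whose neighbourhoods are traced by `ω₁` many filters on sequences of open
sets. -/
theorem exists_point_filters {H : Type u} [TopologicalSpace H] [CompactSpace H] [T2Space H]
    [Nonempty H] (hH : NoIndependentFamily H) :
    ∃ (p : H) (O : (ℵ₁ : Cardinal.{u}).ord.ToType → ℕ → Set H)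
      (F : (ℵ₁ : Cardinal.{u}).ord.ToType → Filter ℕ),
      (∀ η n, IsOpen (O η n)) ∧ (∀ η n, (O η n).Nonempty) ∧ (∀ η, (F η).NeBot) ∧
      ∀ W ∈ 𝓝 p, ∃ γ, ∀ η ≥ γ, {n | O η n ⊆ W} ∈ F η := by
  classical
  obtain ⟨D, ξ, p, hD, hp⟩ := exists_system_and_point hH
  obtain ⟨e⟩ : Nonempty (Iio ξ ↪ (ℵ₁ : Cardinal.{u}).ord.ToType) := by
    rw [← Cardinal.le_def, Cardinal.mk_ord_toType]
    exact lt_aleph_two_iff.1 (mk_Iio_toType_lt ξ)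
  have : Nonempty (ℵ₁ : Cardinal.{u}).ord.ToType :=
    nonempty_toType_of_isRegular Cardinal.isRegular_aleph_one
  let r : (ℵ_ 2 : Cardinal.{u}).ord.ToType → (ℵ₁ : Cardinal.{u}).ord.ToType := fun i =>
    if h : i < ξ then e ⟨i, h⟩ else Classical.arbitrary _
  have hr : InjOn r (Iio ξ) := by
    intro i (hi : i < ξ) j (hj : j < ξ) hij
    simp only [r, hi, hj, dif_pos] at hij
    exact congrArg Subtype.val (e.injective hij)
  -- There are at most `ℵ₁` indices below `ξ`; along `r` the admissible functions become an
  -- increasing `ω₁`-union of countable sets.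
  let N : (ℵ₁ : Cardinal.{u}).ord.ToType → Set (Finset _) := fun η =>
    {τ | IsAdmissible D τ ∧ ∀ q ∈ τ, q.1 < ξ ∧ r q.1 ≤ η}
  have hN : ∀ η, (N η).Countable := by
    intro η
    have h1 : (Iic η).Countable := by
      rw [← Cardinal.le_aleph0_iff_set_countable, ← Order.lt_succ_iff, Cardinal.succ_aleph0]
      exact mk_Iic_toType_lt (Cardinal.aleph0_le_aleph 1) η
    have h2 : {i | i < ξ ∧ r i ≤ η}.Countable := by
      refine MapsTo.countable_of_injOn (f := r) (t := Iic η) (fun i hi => hi.2)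
        (hr.mono fun i hi => hi.1) h1
    have h3 : ({i | i < ξ ∧ r i ≤ η} ×ˢ (Set.univ : Set Bool)).Countable :=
      h2.prod (to_countable _)
    refine MapsTo.countable_of_injOn (f := fun τ : Finset _ => (τ : Set _)) (t := _) ?_
      Finset.coe_injective.injOn (countable_ofPred_finite_subset h3)
    intro τ hτ
    exact ⟨τ.finite_toSet, fun q hq => ⟨hτ.2 q hq, mem_univ _⟩⟩
  have hN0 : ∀ η, (N η).Nonempty := fun η => ⟨∅, isAdmissible_empty, by simp⟩
  choose f hf using fun η => (hN η).exists_eq_range (hN0 η)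
  have hfN : ∀ η n, f η n ∈ N η := fun η n => by
    rw [hf]
    exact mem_range_self n
  let E : Set H → Set (Finset _) := fun W =>
    {τ | IsAdmissible D τ ∧ (∀ q ∈ τ, q.1 < ξ) ∧ cell D τ ⊆ W}
  choose 𝓐 h𝓐E h𝓐c h𝓐 using fun W => exists_maximal_inconsistent (E W) fun τ hτ => hτ.1.1
  -- A countable antichain involves countably many indices, so it appears before `ω₁`.
  have hγ : ∀ W, ∃ γ, 𝓐 W ⊆ N γ := by
    intro W
    have := (h𝓐c W).to_subtype
    obtain ⟨γ, hγ⟩ := exists_forall_lt_of_countable Cardinal.isRegular_aleph_one.{u}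
      Cardinal.aleph0_lt_aleph_one
      (fun q : Σ a : 𝓐 W, {q // q ∈ a.1} => r q.2.1.1)
    exact ⟨γ, fun a ha => ⟨(h𝓐E W ha).1, fun q hq =>
      ⟨(h𝓐E W ha).2.1 q hq, (hγ ⟨⟨a, ha⟩, ⟨q, hq⟩⟩).le⟩⟩⟩
  choose γ hγ using hγ
  have hNmono : ∀ η η', η ≤ η' → N η ⊆ N η' := fun η η' h τ hτ =>
    ⟨hτ.1, fun q hq => ⟨(hτ.2 q hq).1, (hτ.2 q hq).2.trans h⟩⟩
  refine ⟨p, fun η n => cell D (f η n), fun η => generate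
    {B | ∃ W ∈ 𝓝 p, γ W ≤ η ∧ B = {n | cell D (f η n) ⊆ W}}, ?_, ?_, ?_, ?_⟩
  · exact fun η n => isOpen_cell fun q hq => hD _ ((hfN η n).2 q hq).1
  · exact fun η n => cell_nonempty (hfN η n).1 fun q hq => hD _ ((hfN η n).2 q hq).1
  · intro η
    rw [generate_neBot_iff]
    intro t ht htf
    have ht' : ∀ B ∈ t, ∃ W ∈ 𝓝 p, γ W ≤ η ∧ B = {n | cell D (f η n) ⊆ W} := fun B hB => ht hB
    choose! W hWp hWγ hW using ht'
    obtain ⟨τ₀, hτ₀, hτ₀ξ, hτ₀W⟩ := hp _ ((biInter_mem htf).2 fun B hB => hWp B hB)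
    -- Finite intersection property: `τ₀` has its cell in all the given neighbourhoods, so `τ₀ ∪ a`
    -- is compatible with a member of each `𝓐 (W B)`. The union of these members lies in `N η`, even
    -- though `τ₀` need not.
    have key : ∀ s ⊆ t, ∃ a ∈ N η, IsConsistent (τ₀ ∪ a) ∧ ∀ B ∈ s, cell D a ⊆ W B := by
      intro s hs
      induction s, htf.subset hs using Set.Finite.induction_on with
      | empty => exact ⟨∅, ⟨isAdmissible_empty, by simp⟩, by simpa using hτ₀.1, by simp⟩
      | @insert B s _ _ ih =>
        obtain ⟨a, ha, hac, haW⟩ := ih ((subset_insert _ _).trans hs)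
        have hB : B ∈ t := hs (mem_insert _ _)
        obtain ⟨a', ha', hc⟩ := h𝓐 (W B) (τ₀ ∪ a) ⟨hτ₀.union ha.1 hac, fun q hq => by
          rcases Finset.mem_union.1 hq with hq | hq
          exacts [hτ₀ξ q hq, (ha.2 q hq).1], (cell_anti Finset.subset_union_left).trans
            (hτ₀W.trans (biInter_subset_of_mem hB))⟩
        have ha'N := hNmono _ _ (hWγ B hB) (hγ _ ha')
        refine ⟨a ∪ a', ⟨ha.1.union ha'N.1 (hc.mono ?_), fun q hq => ?_⟩, ?_, ?_⟩
        · exact Finset.union_subset_union_left Finset.subset_union_right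
        · rcases Finset.mem_union.1 hq with hq | hq
          exacts [ha.2 q hq, ha'N.2 q hq]
        · rwa [← Finset.union_assoc]
        · intro B' hB'
          rcases hB' with rfl | hB'
          · exact (cell_anti Finset.subset_union_right).trans (h𝓐E _ ha').2.2
          · exact (cell_anti Finset.subset_union_left).trans (haW B' hB')
    obtain ⟨a, ha, -, haW⟩ := key t subset_rfl
    rw [hf] at ha
    obtain ⟨n, rfl⟩ := ha
    refine ⟨n, fun B hB => ?_⟩
    rw [hW B hB]
    exact haW B hB
  · intro W hW
    exact ⟨γ W, fun η hη => mem_generate_of_mem ⟨W, hW, hη, rfl⟩⟩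

/-! ### Products and independent families -/

/-- If a compact space maps continuously onto `2 ^ T` with `T` of size `ℵ₂` and also maps to a
space without large independent families, then some fibre of the latter map covers a face of
the cube of small codimension. -/
theorem exists_fiber_covers_face {E X T : Type u} [TopologicalSpace E] [CompactSpace E] [T2Space E]
    [TopologicalSpace X] [CompactSpace X] [T2Space X] (hX : NoIndependentFamily X)
    {π : E → X} (hπ : Continuous π) {g : E → T → Bool} (hg : Continuous g)
    (hgs : Function.Surjective g) :
    ∃ (x : X) (J : Set T) (c : T → Bool), #J < ℵ_ 2 ∧
      ∀ t : T → Bool, (∀ i ∈ J, t i = c i) → ∃ e, π e = x ∧ g e = t := by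
  classical
  obtain ⟨E', hE'c, hE'g, hE'min⟩ := exists_compact_surjective_zorn_subset hg hgs
  have hE' : IsCompact E' := isCompact_iff_compactSpace.2 hE'c
  have hH : IsClosed (π '' E') := (hE'.image hπ).isClosed
  have hHc : CompactSpace (π '' E') := isCompact_iff_compactSpace.1 (hE'.image hπ)
  have hHne : Nonempty (π '' E') := by
    obtain ⟨e, he, -⟩ := hE'g.symm.subset (mem_univ fun _ => false)
    exact ⟨⟨_, e, he, rfl⟩⟩
  obtain ⟨p, O, F, hO, hOne, hF, hp⟩ := exists_point_filters (hX.subtype hH)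
  -- By minimality of `E'`, the points with `π e ∉ V` do not cover the cube. Over a cylinder missing
  -- their closed image, all points of `E'` project into `O η n`.
  have hcyl : ∀ η n, ∃ (c : T → Bool) (I : Finset T), ∀ t : T → Bool, (∀ i ∈ I, t i = c i) →
      ∃ e, ∃ he : e ∈ E', g e = t ∧ (⟨π e, e, he, rfl⟩ : π '' E') ∈ O η n := by
    intro η n
    obtain ⟨V, hV, hVO⟩ := isOpen_induced_iff.1 (hO η n)
    let E₀ : Set E' := {e | π e ∉ V}
    have hE₀ : IsClosed E₀ :=
      (hV.preimage (hπ.comp continuous_subtype_val)).isClosed_compl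
    have hE₀ne : E₀ ≠ Set.univ := by
      intro h
      obtain ⟨⟨_, e, he, rfl⟩, hh⟩ := hOne η n
      rw [← hVO] at hh
      exact (show π e ∉ V from h.symm.subset (mem_univ (⟨e, he⟩ : E'))) hh
    have himg : IsClosed (E'.domRestrict g '' E₀) :=
      (hE₀.isCompact.image (hg.comp continuous_subtype_val)).isClosed
    obtain ⟨c, hc⟩ := (ne_univ_iff_exists_notMem _).1 (hE'min E₀ hE₀ne hE₀)
    obtain ⟨I, v, hv, hIv⟩ := isOpen_pi_iff.1 himg.isOpen_compl c hc
    refine ⟨c, I, fun t ht => ?_⟩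
    obtain ⟨e, he, het⟩ := hE'g.symm.subset (mem_univ t)
    refine ⟨e, he, het, ?_⟩
    rw [← hVO]
    by_contra hcon
    refine hIv (a := t) (fun i hi => ?_) ⟨⟨e, he⟩, hcon, het⟩
    rw [ht i hi]
    exact (hv i hi).2
  choose c I hcI using hcyl
  let J : Set T := ⋃ q : (ℵ₁ : Cardinal.{u}).ord.ToType × ULift.{u} ℕ, (I q.1 q.2.down : Set T)
  have hJ : #J < ℵ_ 2 := by
    refine (Cardinal.card_iUnion_lt_iff_forall_of_isRegular isRegular_aleph_two ?_).2 ?_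
    · rw [Cardinal.mk_prod]
      simp only [Cardinal.mk_ord_toType, Cardinal.lift_id, Cardinal.mk_uLift, Cardinal.mk_nat,
        Cardinal.lift_aleph0]
      exact Cardinal.mul_lt_of_lt aleph0_lt_aleph_two.le (lt_aleph_two_iff.2 le_rfl)
        aleph0_lt_aleph_two
    · intro q
      exact (Cardinal.lt_aleph0_of_finite _).trans aleph0_lt_aleph_two
  let merge : (T → Bool) → (T → Bool) → T → Bool := fun a t i => if i ∈ J then a i else t i
  let ι := {W : Set X // W ∈ 𝓝 p.1 ∧ IsClosed W}
  have hιne : Nonempty ι := ⟨⟨Set.univ, univ_mem, isClosed_univ⟩⟩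
  have hdirι : ∀ W W' : ι, ∃ W'' : ι, W''.1 ⊆ W.1 ∧ W''.1 ⊆ W'.1 := fun W W' =>
    ⟨⟨W.1 ∩ W'.1, inter_mem W.2.1 W'.2.1, W.2.2.inter W'.2.2⟩, inter_subset_left,
      inter_subset_right⟩
  let C : ι → Set (T → Bool) := fun W => g '' (E' ∩ π ⁻¹' W.1)
  have hcomp : ∀ W : ι, IsCompact (E' ∩ π ⁻¹' W.1) := fun W =>
    hE'.inter_right (W.2.2.preimage hπ)
  have hC : ∀ W, IsClosed (C W) := fun W => ((hcomp W).image hg).isClosed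
  -- Assignments on `J` whose entire face is covered from above `W`. Each `Q W` contains some `c γ
  -- n`, and compactness gives one assignment good for all `W`.
  let Q : ι → Set (T → Bool) := fun W => {a | ∀ t, merge a t ∈ C W}
  have hQ : ∀ W, IsClosed (Q W) := by
    intro W
    have : Q W = ⋂ t, (fun a => merge a t) ⁻¹' C W := by
      ext a
      simp [Q]
    rw [this]
    refine isClosed_iInter fun t => (hC W).preimage (continuous_pi fun i => ?_)
    by_cases hi : i ∈ J
    · simpa [merge, hi] using continuous_apply i
    · simpa [merge, hi] using continuous_const
  obtain ⟨a, ha⟩ : (⋂ W, Q W).Nonempty := by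
    refine IsCompact.nonempty_iInter_of_directed_nonempty_isCompact_isClosed Q ?_ ?_
      (fun W => (hQ W).isCompact) hQ
    · intro W W'
      obtain ⟨W'', h1, h2⟩ := hdirι W W'
      exact ⟨W'', fun a ha t => image_mono (inter_subset_inter_right _ (preimage_mono h1)) (ha t),
        fun a ha t => image_mono (inter_subset_inter_right _ (preimage_mono h2)) (ha t)⟩
    · intro W
      obtain ⟨γ, hγ⟩ := hp (Subtype.val ⁻¹' W.1)
        (continuous_subtype_val.continuousAt W.2.1)
      obtain ⟨n, hn⟩ := (hF γ).nonempty_of_mem (hγ γ le_rfl)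
      refine ⟨c γ n, fun t => ?_⟩
      obtain ⟨e, he, hge, heO⟩ := hcI γ n (merge (c γ n) t) fun i hi => by
        have : i ∈ J := mem_iUnion.2 ⟨(γ, ⟨n⟩), hi⟩
        simp [merge, this]
      exact ⟨e, ⟨he, hn heO⟩, hge⟩
  refine ⟨p.1, J, a, hJ, fun t ht => ?_⟩
  have hmt : merge a t = t := by
    ext i
    by_cases hi : i ∈ J
    · simp [merge, hi, ht i hi]
    · simp [merge, hi]
  -- Compactness again, now for a fixed `t`, moves the preimage from above every `W` to the fibre
  -- over `p`.
  obtain ⟨e, he⟩ : (⋂ W : ι, (E' ∩ π ⁻¹' W.1) ∩ g ⁻¹' {t}).Nonempty := by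
    have hcl : ∀ W : ι, IsCompact ((E' ∩ π ⁻¹' W.1) ∩ g ⁻¹' {t}) := fun W =>
      (hcomp W).inter_right (isClosed_singleton.preimage hg)
    refine IsCompact.nonempty_iInter_of_directed_nonempty_isCompact_isClosed _ ?_ ?_ hcl
      fun W => (hcl W).isClosed
    · intro W W'
      obtain ⟨W'', h1, h2⟩ := hdirι W W'
      exact ⟨W'', fun e he => ⟨⟨he.1.1, h1 he.1.2⟩, he.2⟩, fun e he => ⟨⟨he.1.1, h2 he.1.2⟩, he.2⟩⟩
    · intro W
      obtain ⟨e, he, het⟩ := mem_iInter.1 ha W t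
      exact ⟨e, he, het.trans hmt⟩
  rw [mem_iInter] at he
  refine ⟨e, ?_, (he hιne.some).2⟩
  by_contra hne
  obtain ⟨W, hW, hWc, hWs⟩ := exists_mem_nhds_isClosed_subset
    (isOpen_compl_singleton.mem_nhds (Ne.symm hne) : {π e}ᶜ ∈ 𝓝 p.1)
  exact hWs (he ⟨W, hW, hWc⟩).1.2 rfl

/-- Some fibre over `x : X` covers a face with `ℵ₂` free coordinates. On this fibre the second
coordinate is injective, so the face gives an independent family on `Y`. -/
theorem NoIndependentFamily.prod {X Y : Type u} [TopologicalSpace X] [CompactSpace X] [T2Space X]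
    [TopologicalSpace Y] [CompactSpace Y] [T2Space Y] (hX : NoIndependentFamily X)
    (hY : NoIndependentFamily Y) : NoIndependentFamily (X × Y) := by
  classical
  intro T hT C hC hd
  by_contra! hne
  obtain ⟨F, f, hF, hf, hfs, -⟩ := exists_surjective_of_independent hC hd fun s b => hne s b
  have : CompactSpace F := isCompact_iff_compactSpace.1 hF.isCompact
  obtain ⟨x, J, c, hJ, hface⟩ := exists_fiber_covers_face hX
    (continuous_fst.comp (continuous_subtype_val (p := (· ∈ F)))) hf hfs
  have hTinf : Infinite T := by
    rw [Cardinal.infinite_iff, hT]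
    exact aleph0_lt_aleph_two.le
  have hJc : #(Jᶜ : Set T) = ℵ_ 2 := by
    rw [Cardinal.mk_compl_of_infinite J (hT ▸ hJ), hT]
  let P : (Jᶜ : Set T) → Bool → Set F := fun i b =>
    {e | e.1.1 = x ∧ (∀ j ∈ J, f e j = c j) ∧ f e i = b}
  have hP : ∀ i b, IsClosed (P i b) := by
    intro i b
    refine (isClosed_singleton.preimage (continuous_fst.comp continuous_subtype_val)).inter
      (IsClosed.inter ?_ ?_)
    · have : {e | ∀ j ∈ J, f e j = c j} = ⋂ j ∈ J, {e | f e j = c j} := by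
        ext e
        simp
      have hcl : IsClosed {e | ∀ j ∈ J, f e j = c j} := this ▸ isClosed_biInter fun j _ =>
        isClosed_singleton.preimage ((continuous_apply j).comp hf)
      exact hcl
    · exact isClosed_singleton.preimage ((continuous_apply i.1).comp hf)
  obtain ⟨s, b, h⟩ := hY (Jᶜ : Set T) hJc (fun i b => (fun e : F => e.1.2) '' P i b)
    (fun i b => ((hP i b).isCompact.image
      (continuous_snd.comp continuous_subtype_val)).isClosed)
    (fun i => by
      rw [Set.disjoint_left]
      rintro _ ⟨e, he, rfl⟩ ⟨e', he', hee'⟩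
      have : e = e' := Subtype.ext (Prod.ext (he.1.trans he'.1.symm) hee'.symm)
      subst this
      exact absurd (he.2.2.symm.trans he'.2.2) (by simp))
  obtain ⟨e, hex, het⟩ := hface (fun i => if h : i ∈ J then c i else b ⟨i, h⟩)
    fun i hi => by simp [hi]
  refine notMem_empty e.1.2 (h.subset (mem_iInter₂.2 fun i _ => ⟨e, ⟨hex, ?_, ?_⟩, rfl⟩))
  · intro j hj
    simp [het, hj]
  · have : i.1 ∉ J := i.2
    simp [het, this]

/-! ### Sequences of length `ω₁` in products of pseudoradial spaces -/

/-- A sequence escaping the union has fewer than `κ` terms in each `C γ`. If `κ < ℵ₁`, one `C γ`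
would contain all terms; if `κ > ℵ₁`, regularity would leave too few terms in the union. So `κ =
ℵ₁`. -/
theorem exists_tendsto_of_not_isClosed_iUnion {X : Type u} [TopologicalSpace X]
    (hX : IsPseudoradial X) {C : (ℵ₁ : Cardinal.{u}).ord.ToType → Set X}
    (hC : ∀ γ, IsClosed (C γ)) (hmono : Monotone C) (hnc : ¬ IsClosed (⋃ γ, C γ)) :
    ∃ (x : X) (y : (ℵ₁ : Cardinal.{u}).ord.ToType → X),
      (∀ γ, y γ ∈ (⋃ γ, C γ) \ C γ) ∧ Tendsto y atTop (𝓝 x) := by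
  have hnr : ¬ IsRadiallyClosed (⋃ γ, C γ) := fun h => hnc (isPseudoradial_iff.1 hX _ h)
  simp only [IsRadiallyClosed, not_forall] at hnr
  obtain ⟨κ, hκ, s, hs, x, hx, hxn⟩ := hnr
  have hbad : ∀ γ, #{i | s i ∈ C γ} < κ := by
    intro γ
    have := hx (C γ)ᶜ ((hC γ).isOpen_compl.mem_nhds fun h => hxn (mem_iUnion.2 ⟨γ, h⟩))
    simpa using this
  have hall : ¬ ∃ γ, ∀ i, s i ∈ C γ := by
    rintro ⟨γ, hγ⟩
    have h := hbad γ
    have h2 : {i | s i ∈ C γ} = Set.univ := eq_univ_of_forall hγ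
    rw [h2, Cardinal.mk_univ, Cardinal.mk_ord_toType] at h
    exact lt_irrefl _ h
  have hκ1 : κ = ℵ₁ := by
    rcases lt_trichotomy κ ℵ₁ with h | h | h
    · exfalso
      choose r hr using fun i => mem_iUnion.1 (hs i)
      obtain ⟨γ, hγ⟩ := exists_forall_lt_of_lift_mk_lt Cardinal.isRegular_aleph_one
        (Cardinal.lift_lt.2 (by simpa using h)) r
      exact hall ⟨γ, fun i => hmono (hγ i).le (hr i)⟩
    · exact h
    · exfalso
      have h1 := (Cardinal.card_iUnion_lt_iff_forall_of_isRegular (t := fun γ => {i | s i ∈ C γ})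
        hκ (by simpa using h)).2 hbad
      have h2 : ⋃ γ, {i | s i ∈ C γ} = Set.univ := eq_univ_of_forall fun i => by
        simpa using hs i
      rw [h2, Cardinal.mk_univ, Cardinal.mk_ord_toType] at h1
      exact lt_irrefl _ h1
  subst hκ1
  have hex : ∀ γ, ∃ j, γ < j ∧ s j ∉ C γ := by
    intro γ
    by_contra! hcon
    have hcov : (Set.univ : Set (ℵ₁ : Cardinal.{u}).ord.ToType) ⊆
        Iic γ ∪ {i | s i ∈ C γ} := fun i _ => by
      by_cases hi : i ≤ γ
      · exact Or.inl hi
      · exact Or.inr (hcon i (not_le.1 hi))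
    have h := (Cardinal.mk_le_mk_of_subset hcov).trans (Cardinal.mk_union_le _ _)
    rw [Cardinal.mk_univ, Cardinal.mk_ord_toType] at h
    exact absurd h (not_le.2 (Cardinal.add_lt_of_lt hκ.aleph0_le
      (mk_Iic_toType_lt hκ.aleph0_le γ) (hbad γ)))
  choose j hj hjC using hex
  refine ⟨x, s ∘ j, fun γ => ⟨hs _, hjC γ⟩, fun U hU => ?_⟩
  obtain ⟨γ, hγ⟩ := exists_forall_lt_of_mk_lt hκ (hx U hU)
  refine mem_map.2 (mem_of_superset (Ici_mem_atTop γ) fun η hη => ?_)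
  by_contra hcon
  exact lt_irrefl _ (((hγ (j η) hcon).trans_le hη).trans (hj η))

/-- If all sets `⋃ γ, G δ γ` are closed, a common point `x` lifts to every tail. Otherwise an
`ω₁`-sequence leaves such a union, and its terms, being outside `G δ γ`, lift to closures of tails.
-/
theorem exists_tendsto_comp {Z X : Type u} [TopologicalSpace Z] [CompactSpace Z]
    [TopologicalSpace X] [CompactSpace X] [T2Space X] (hX : IsPseudoradial X)
    {π : Z → X} (hπ : Continuous π) {A : Set Z}
    (hA : ∀ C : Set Z, C.Countable → C ⊆ A → closure C ⊆ A)
    {a : (ℵ₁ : Cardinal.{u}).ord.ToType → Z} (ha : ∀ γ, a γ ∈ A) :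
    ∃ (x : X) (g : (ℵ₁ : Cardinal.{u}).ord.ToType → Z),
      (∀ γ, g γ ∈ A ∧ g γ ∈ closure (a '' Ici γ)) ∧ Tendsto (π ∘ g) atTop (𝓝 x) := by
  have hcount : ∀ δ γ : (ℵ₁ : Cardinal.{u}).ord.ToType, (Icc δ γ).Countable := by
    intro δ γ
    rw [← Cardinal.le_aleph0_iff_set_countable, ← Order.lt_succ_iff, Cardinal.succ_aleph0]
    exact (Cardinal.mk_le_mk_of_subset Icc_subset_Iic_self).trans_lt
      (mk_Iic_toType_lt (Cardinal.aleph0_le_aleph 1) γ)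
  have hclA : ∀ δ γ, closure (a '' Icc δ γ) ⊆ A := fun δ γ =>
    hA _ ((hcount δ γ).image a) (by rintro _ ⟨i, -, rfl⟩; exact ha i)
  let G : (ℵ₁ : Cardinal.{u}).ord.ToType → (ℵ₁ : Cardinal.{u}).ord.ToType → Set X :=
    fun δ γ => π '' closure (a '' Icc δ γ)
  have hGc : ∀ δ γ, IsClosed (G δ γ) := fun δ γ =>
    (isClosed_closure.isCompact.image hπ).isClosed
  have hGm : ∀ δ, Monotone (G δ) := fun δ γ γ' h =>
    image_mono (closure_mono (image_mono (Icc_subset_Icc_right h)))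
  have hGa : ∀ γ, Antitone fun δ => G δ γ := fun γ δ δ' h =>
    image_mono (closure_mono (image_mono (Icc_subset_Icc_left h)))
  have : Nonempty (ℵ₁ : Cardinal.{u}).ord.ToType :=
    nonempty_toType_of_isRegular Cardinal.isRegular_aleph_one
  by_cases hcl : ∀ δ, IsClosed (⋃ γ, G δ γ)
  · obtain ⟨x, hx⟩ : (⋂ δ, ⋃ γ, G δ γ).Nonempty := by
      refine IsCompact.nonempty_iInter_of_directed_nonempty_isCompact_isClosed _ ?_ ?_
        (fun δ => (hcl δ).isCompact) hcl
      · refine Antitone.directed_ge fun δ δ' h => iUnion_mono fun γ => hGa γ h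
      · exact fun δ => ⟨π (a δ), mem_iUnion.2 ⟨δ, a δ, subset_closure ⟨δ, by simp, rfl⟩, rfl⟩⟩
    have hx' : ∀ δ, ∃ g, (g ∈ A ∧ g ∈ closure (a '' Ici δ)) ∧ π g = x := by
      intro δ
      obtain ⟨γ, g, hg, hgx⟩ := mem_iUnion.1 (mem_iInter.1 hx δ)
      exact ⟨g, ⟨hclA _ _ hg, closure_mono (image_mono Icc_subset_Ici_self) hg⟩, hgx⟩
    choose g hg hgx using hx'
    refine ⟨x, g, hg, ?_⟩
    rw [show π ∘ g = fun _ => x from funext hgx]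
    exact tendsto_const_nhds
  · push Not at hcl
    obtain ⟨δ, hδ⟩ := hcl
    obtain ⟨x, y, hy, hyx⟩ := exists_tendsto_of_not_isClosed_iUnion hX (hGc δ) (hGm δ) hδ
    have hlift : ∀ γ, ∃ g, (g ∈ A ∧ g ∈ closure (a '' Ici γ)) ∧ π g = y γ := by
      intro γ
      obtain ⟨γ', g, hg, hgy⟩ := mem_iUnion.1 (hy γ).1
      refine ⟨g, ⟨hclA _ _ hg, ?_⟩, hgy⟩
      have hsub : a '' Icc δ γ' ⊆ a '' Icc δ γ ∪ a '' Ici γ := by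
        rintro _ ⟨i, hi, rfl⟩
        rcases le_total i γ with h | h
        · exact Or.inl ⟨i, ⟨hi.1, h⟩, rfl⟩
        · exact Or.inr ⟨i, h, rfl⟩
      have hg' := closure_mono hsub hg
      rw [closure_union] at hg'
      exact hg'.resolve_left fun h => (hy γ).2 ⟨g, h, hgy⟩
    choose g hg hgy using hlift
    refine ⟨x, g, hg, ?_⟩
    rwa [show π ∘ g = y from funext hgy]

/-- Make the first coordinates converge, then the second. The second pass preserves the first limit
because its points lie in closures of tails. -/
theorem exists_cluster_mem_of_prod {X Y : Type u} [TopologicalSpace X] [CompactSpace X] [T2Space X]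
    [TopologicalSpace Y] [CompactSpace Y] [T2Space Y] (hX : IsPseudoradial X)
    (hY : IsPseudoradial Y) {A : Set (X × Y)} (hrad : IsRadiallyClosed A)
    (hA : ∀ C : Set (X × Y), C.Countable → C ⊆ A → closure C ⊆ A)
    {a : (ℵ₁ : Cardinal.{u}).ord.ToType → X × Y} (ha : ∀ γ, a γ ∈ A) :
    ∃ z ∈ A, ∀ γ, z ∈ closure (a '' Ici γ) := by
  have : Nonempty (ℵ₁ : Cardinal.{u}).ord.ToType :=
    nonempty_toType_of_isRegular Cardinal.isRegular_aleph_one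
  obtain ⟨x, g, hg, hgx⟩ := exists_tendsto_comp hX continuous_fst hA ha
  obtain ⟨y, g', hg', hgy⟩ := exists_tendsto_comp hY continuous_snd hA fun γ => (hg γ).1
  have hcl : ∀ γ, closure (g '' Ici γ) ⊆ closure (a '' Ici γ) := fun γ =>
    closure_minimal (by
      rintro _ ⟨i, hi, rfl⟩
      exact closure_mono (image_mono (Ici_subset_Ici.2 hi)) (hg i).2) isClosed_closure
  have hgx' : Tendsto (Prod.fst ∘ g') atTop (𝓝 x) := by
    intro U hU
    obtain ⟨W, hW, hWc, hWU⟩ := exists_mem_nhds_isClosed_subset hU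
    obtain ⟨γ, hγ⟩ := mem_atTop_sets.1 (hgx hW)
    refine mem_map.2 (mem_of_superset (Ici_mem_atTop γ) fun η hη => hWU ?_)
    have hsub : closure (g '' Ici η) ⊆ Prod.fst ⁻¹' W :=
      closure_minimal (by
        rintro _ ⟨i, hi, rfl⟩
        exact hγ i (le_trans (mem_Ici.1 hη) hi)) (hWc.preimage continuous_fst)
    exact hsub (hg' η).2
  have hlim : Tendsto g' atTop (𝓝 (x, y)) := by
    rw [nhds_prod_eq]
    exact hgx'.prodMk hgy
  refine ⟨(x, y), hrad.mem_of_tendsto Cardinal.isRegular_aleph_one (fun γ => (hg' γ).1) hlim,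
    fun γ => ?_⟩
  refine isClosed_closure.mem_of_tendsto hlim
    (mem_of_superset (Ici_mem_atTop γ) fun η hη => ?_)
  exact closure_mono (image_mono (Ici_subset_Ici.2 (mem_Ici.1 hη))) (hcl η (hg' η).2)

/-! ### Closedness of radially closed sets -/

/-- The part of the closure of `A` on which all functions in `I` vanish. -/
def zerosIn {Z : Type u} [TopologicalSpace Z] (A : Set Z) (I : Set C(Z, ℝ)) : Set Z :=
  closure A ∩ {z | ∀ f ∈ I, f z = 0}

theorem zerosIn_anti {Z : Type u} [TopologicalSpace Z] {A : Set Z} {I J : Set C(Z, ℝ)}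
    (h : I ⊆ J) : zerosIn A J ⊆ zerosIn A I :=
  fun _ hz => ⟨hz.1, fun f hf => hz.2 f (h hf)⟩

theorem isClosed_zerosIn {Z : Type u} [TopologicalSpace Z] (A : Set Z) (I : Set C(Z, ℝ)) :
    IsClosed (zerosIn A I) := by
  refine isClosed_closure.inter ?_
  have : {z | ∀ f ∈ I, f z = 0} = ⋂ f ∈ I, f ⁻¹' {0} := by
    ext z
    simp
  rw [this]
  exact isClosed_biInter fun f _ => isClosed_singleton.preimage f.continuous

theorem mem_closure_of_mapClusterPt {Z : Type u} {α : Type v} [TopologicalSpace Z] {z : Z}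
    {l : Filter α} {a : α → Z} (h : MapClusterPt z l a) {S : Set Z} (hS : ∀ᶠ i in l, a i ∈ S) :
    z ∈ closure S :=
  mem_closure_iff_clusterPt.2 (ClusterPt.mono h (le_principal_iff.2 hS))

theorem zerosIn_inter_nonempty_of_countable {Z : Type u} [TopologicalSpace Z] [CompactSpace Z]
    {A : Set Z} (hA : ∀ C : Set Z, C.Countable → C ⊆ A → closure C ⊆ A) {I : Set C(Z, ℝ)}
    (hI : I.Countable) (hne : (zerosIn A I).Nonempty) : (zerosIn A I ∩ A).Nonempty := by
  -- Inserting `0` allows an enumeration by `ℕ` even for empty `I`, without changing the zeros.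
  obtain ⟨f, hf⟩ := (hI.insert 0).exists_eq_range (insert_nonempty 0 I)
  obtain ⟨z, hzA, hz⟩ := hne
  have hfz : ∀ n, f n z = 0 := by
    intro n
    rcases hf.symm.subset (mem_range_self n) with h | h
    · simp [h]
    · exact hz _ h
  have hex : ∀ m : ℕ, ∃ a ∈ A, ∀ n ≤ m, |f n a| < 1 / ((m : ℝ) + 1) := by
    intro m
    have hopen : IsOpen (⋂ n ∈ Iic m, {w | |f n w| < 1 / ((m : ℝ) + 1)}) :=
      (finite_Iic m).isOpen_biInter fun n _ =>
        isOpen_lt (f n).continuous.abs continuous_const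
    obtain ⟨a, ha, haA⟩ := mem_closure_iff.1 hzA _ hopen (mem_iInter₂.2 fun n _ => by
      simp only [mem_ofPred_eq, hfz, abs_zero]
      positivity)
    exact ⟨a, haA, fun n hn => mem_iInter₂.1 ha n hn⟩
  choose a haA ha using hex
  obtain ⟨w, hw⟩ := exists_clusterPt_of_compactSpace (map a atTop)
  have hwA : w ∈ A := hA _ (countable_range a) (range_subset_iff.2 haA)
    (mem_closure_of_mapClusterPt hw (Eventually.of_forall fun n => mem_range_self n))
  refine ⟨w, ⟨subset_closure hwA, fun g hg => ?_⟩, hwA⟩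
  obtain ⟨n, rfl⟩ := hf.subset (mem_insert_of_mem 0 hg)
  have hle : ∀ᶠ m : ℕ in atTop, |f n w| ≤ 1 / ((m : ℝ) + 1) := by
    filter_upwards [eventually_ge_atTop n] with m hm
    have hcl : IsClosed {w | |f n w| ≤ 1 / ((m : ℝ) + 1)} :=
      isClosed_le (f n).continuous.abs continuous_const
    refine hcl.closure_subset (mem_closure_of_mapClusterPt hw ?_)
    filter_upwards [eventually_ge_atTop m] with k hk
    refine (ha k n (hm.trans hk)).le.trans ?_
    gcongr
  have := ge_of_tendsto (tendsto_one_div_add_atTop_nhds_zero_nat (𝕜 := ℝ)) hle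
  simpa using this

theorem exists_cofinal_monotone {μ : Cardinal.{u}} (hμ : ℵ₀ ≤ μ) :
    ∃ (θ : Cardinal.{u}) (c : θ.ord.ToType → μ.ord.ToType), θ.IsRegular ∧ Monotone c ∧
      ∀ i, ∃ α, i ≤ c α := by
  obtain ⟨s, hs, hst⟩ := Ordinal.exists_ord_cof_eq μ.ord.ToType
  rw [Ordinal.cof_toType] at hst
  have : Ordinal.type (fun x y : μ.ord.cof.ord.ToType => x < y) =
      Ordinal.type (fun x y : s => x < y) := by
    rw [hst, Ordinal.type_toType]
  obtain ⟨e⟩ := Ordinal.type_eq.1 this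
  refine ⟨μ.ord.cof, fun α => (e α).1, Cardinal.isRegular_cof (Cardinal.isSuccLimit_ord hμ), ?_,
    fun i => ?_⟩
  · intro α β h
    rcases h.lt_or_eq with h | rfl
    · exact (e.map_rel_iff.2 h).le
    · exact le_rfl
  · obtain ⟨j, hj, hij⟩ := hs i
    exact ⟨e.symm ⟨j, hj⟩, by simpa using hij⟩

theorem exists_disjoint_zerosIn {Z : Type u} [TopologicalSpace Z] [NormalSpace Z] [T1Space Z]
    {A : Set Z} (hA : ¬ IsClosed A) :
    ∃ I : Set C(Z, ℝ), (zerosIn A I).Nonempty ∧ Disjoint (zerosIn A I) A := by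
  obtain ⟨x, hx, hxA⟩ := not_subset.1 fun h => hA (isClosed_of_closure_subset h)
  refine ⟨{f | f x = 0}, ⟨x, hx, fun f hf => hf⟩, Set.disjoint_left.2 fun z hz hzA => ?_⟩
  have hzx : z ≠ x := fun h => hxA (h ▸ hzA)
  obtain ⟨f, hf0, hf1, -⟩ := exists_continuous_zero_one_of_isClosed
    (isClosed_singleton (x := x)) (isClosed_singleton (x := z))
    (by simpa using hzx.symm)
  have h0 := hz.2 f (hf0 rfl)
  have h1 := hf1 (mem_singleton z)
  rw [h0] at h1
  exact zero_ne_one h1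

theorem isClosed_of_isRadiallyClosed {Z : Type u} [TopologicalSpace Z] [CompactSpace Z]
    [T2Space Z] (hZ : NoIndependentFamily Z) {A : Set Z} (hrad : IsRadiallyClosed A)
    (hA : ∀ C : Set Z, C.Countable → C ⊆ A → closure C ⊆ A)
    (hA1 : ∀ a : (ℵ₁ : Cardinal.{u}).ord.ToType → Z, (∀ γ, a γ ∈ A) →
      ∃ z ∈ A, ∀ γ, z ∈ closure (a '' Ici γ)) :
    IsClosed A := by
  by_contra hnc
  -- Minimality is used through `hmeet`: a nonempty zero set of fewer than `#I` functions must meet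
  -- `A`.
  obtain ⟨I, ⟨hIne, hId⟩, hImin⟩ := exists_minimalFor_of_wellFoundedLT
    (fun I : Set C(Z, ℝ) => (zerosIn A I).Nonempty ∧ Disjoint (zerosIn A I) A)
    (fun I => #I) (exists_disjoint_zerosIn hnc)
  have hmeet : ∀ J : Set C(Z, ℝ), #J < #I → (zerosIn A J).Nonempty →
      (zerosIn A J ∩ A).Nonempty := by
    intro J hJ hJne
    rw [← not_disjoint_iff_nonempty_inter]
    exact fun hd => absurd hJ (not_lt.2 (hImin ⟨hJne, hd⟩ hJ.le))
  have hI0 : ℵ₀ < #I := by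
    by_contra hle
    exact (not_disjoint_iff_nonempty_inter.2 (zerosIn_inter_nonempty_of_countable hA
      (Cardinal.le_aleph0_iff_set_countable.1 (not_lt.1 hle)) hIne)) hId
  obtain ⟨θ, c, hθ, hcm, hcc⟩ := exists_cofinal_monotone hI0.le
  obtain ⟨e⟩ : Nonempty ((#I).ord.ToType ≃ I) := Cardinal.eq.1 (Cardinal.mk_ord_toType _)
  let Iα : θ.ord.ToType → Set C(Z, ℝ) := fun α => (fun i => (e i).1) '' Iic (c α)
  have hIα : ∀ α, #(Iα α) < #I := fun α =>
    Cardinal.mk_image_le.trans_lt (mk_Iic_toType_lt hI0.le (c α))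
  have hIαI : ∀ α, Iα α ⊆ I := by
    rintro α _ ⟨i, -, rfl⟩
    exact (e i).2
  let H : θ.ord.ToType → Set Z := fun α => zerosIn A (Iα α)
  have hHanti : Antitone H := fun α β h =>
    zerosIn_anti (image_mono (Iic_subset_Iic.2 (hcm h)))
  have hHc : ∀ α, IsClosed (H α) := fun α => isClosed_zerosIn _ _
  have hHI : ∀ z, (∀ α, z ∈ H α) → z ∈ zerosIn A I := by
    intro z hz
    obtain ⟨α₀, -⟩ := hcc (e.symm ⟨_, (Cardinal.mk_ne_zero_iff.1
      (Cardinal.aleph0_pos.trans hI0).ne').some.2⟩)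
    refine ⟨(hz α₀).1, fun f hf => ?_⟩
    obtain ⟨α, hα⟩ := hcc (e.symm ⟨f, hf⟩)
    exact (hz α).2 f ⟨e.symm ⟨f, hf⟩, hα, by simp⟩
  have hθne := nonempty_toType_of_isRegular hθ
  have hbase : ∀ α, (H α ∩ A).Nonempty := fun α =>
    hmeet _ (hIα α) (hIne.mono (zerosIn_anti (hIαI α)))
  have hcontra : ∀ z ∈ A, ¬ ∀ α, z ∈ H α := fun z hz h =>
    Set.disjoint_left.1 hId (hHI z h) hz
  choose a haH haA using hbase
  have htail : ∀ α, a '' Ici α ⊆ H α := by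
    rintro α _ ⟨β, hβ, rfl⟩
    exact hHanti hβ (haH β)
  rcases hθ.aleph0_le.eq_or_lt with hθ0 | hθ0
  · obtain ⟨w, hw⟩ := exists_clusterPt_of_compactSpace (map a atTop)
    have hcnt : Countable θ.ord.ToType := by
      rw [← Cardinal.mk_le_aleph0_iff, Cardinal.mk_ord_toType, ← hθ0]
    refine hcontra w (hA _ (countable_range a) (range_subset_iff.2 haA)
      (mem_closure_of_mapClusterPt hw (Eventually.of_forall fun n => mem_range_self n)))
      fun α => (hHc α).closure_subset (mem_closure_of_mapClusterPt hw ?_)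
    filter_upwards [eventually_ge_atTop α] with β hβ
    exact htail α ⟨β, hβ, rfl⟩
  have hθ1 : ℵ₁ ≤ θ := by
    rw [← Cardinal.succ_aleph0]
    exact Order.succ_le_of_lt hθ0
  rcases hθ1.eq_or_lt with rfl | hθ1
  · obtain ⟨z, hzA, hz⟩ := hA1 a haA
    exact hcontra z hzA fun α => closure_minimal (htail α) (hHc α) (hz α)
  -- a point of the intersection with a small trace, reached by a sequence of length `θ`
  have hK : IsClosed (zerosIn A I) := isClosed_zerosIn A I
  have hKc : CompactSpace (zerosIn A I) := isCompact_iff_compactSpace.1 hK.isCompact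
  have hKne : Nonempty (zerosIn A I) := hIne.to_subtype
  obtain ⟨p, O, F, hO, hOne, hF, hp⟩ := exists_point_filters (hZ.subtype hK)
  -- One extra function cuts the zero set down to a nonempty part of `O η n`. Adding it to `Iα α`
  -- keeps the size below `#I`, which supplies the points `v` of `A`.
  have hq : ∀ η n, ∃ q : C(Z, ℝ), (∃ z ∈ zerosIn A I, q z = 0) ∧
      ∀ z : zerosIn A I, q z = 0 → z ∈ O η n := by
    intro η n
    obtain ⟨V, hV, hVO⟩ := isOpen_induced_iff.1 (hO η n)
    obtain ⟨z, hz⟩ := hOne η n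
    obtain ⟨f, hf0, hf1, -⟩ := exists_continuous_zero_one_of_isClosed
      (isClosed_singleton (x := z.1)) hV.isClosed_compl (by
        rw [← hVO] at hz
        simpa using hz)
    refine ⟨f, ⟨z, z.2, hf0 rfl⟩, fun w hw => ?_⟩
    rw [← hVO]
    by_contra hwV
    have := hf1 hwV
    rw [hw] at this
    exact zero_ne_one this
  choose q hq0 hqO using hq
  have hv : ∀ α η n, ∃ v ∈ A, v ∈ H α ∧ q η n v = 0 := by
    intro α η n
    obtain ⟨z, hz, hqz⟩ := hq0 η n
    obtain ⟨v, hv, hvA⟩ := hmeet (insert (q η n) (Iα α))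
      (Cardinal.mk_insert_le.trans_lt (Cardinal.add_lt_of_lt hI0.le (hIα α)
        (Cardinal.one_lt_aleph0.trans hI0)))
      ⟨z, hz.1, by
        rintro f (rfl | hf)
        · exact hqz
        · exact hz.2 f (hIαI α hf)⟩
    exact ⟨v, hvA, zerosIn_anti (subset_insert _ _) hv, hv.2 _ (mem_insert _ _)⟩
  choose v hvA hvH hvq using hv
  have hb : ∀ α η, ∃ b, MapClusterPt b (F η) (v α η) := fun α η =>
    exists_clusterPt_of_compactSpace (map (v α η) (F η))
  choose b hb using hb
  have hbA : ∀ α η, b α η ∈ A := fun α η =>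
    hA _ (countable_range (v α η)) (range_subset_iff.2 (hvA α η))
      (mem_closure_of_mapClusterPt (hb α η) (Eventually.of_forall fun n => mem_range_self n))
  choose d hdA hd using fun α => hA1 (b α) (hbA α)
  have hlim : Tendsto d atTop (𝓝 p.1) := by
    intro W hW
    obtain ⟨W', hW', hW'c, hW'W⟩ := exists_mem_nhds_isClosed_subset hW
    obtain ⟨γ, hγ⟩ := hp (Subtype.val ⁻¹' interior W')
      (continuous_subtype_val.continuousAt (interior_mem_nhds.2 hW'))
    -- The sets `H α ∩ q η n ⁻¹' {0}` decrease to a subset of `O η n`, so by compactness one of them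
    -- enters `W'`. Since `ℵ₁ < θ`, a single `α₀` then serves all `η` and `n`.
    have hα : ∀ η n, ∃ α, O η n ⊆ Subtype.val ⁻¹' interior W' →
        H α ∩ q η n ⁻¹' {0} ⊆ interior W' := by
      intro η n
      by_cases hsub : O η n ⊆ Subtype.val ⁻¹' interior W'
      · obtain ⟨α, hα⟩ := exists_subset_nhds_of_compactSpace
          (V := fun α => H α ∩ q η n ⁻¹' {0}) (U := interior W')
          (Antitone.directed_ge fun α β h => inter_subset_inter_left _ (hHanti h))
          (fun α => (hHc α).inter (isClosed_singleton.preimage (q η n).continuous))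
          (fun z hz => by
            rw [mem_iInter] at hz
            have hzI := hHI z fun α => (hz α).1
            have hzq : q η n z = 0 := (hz hθne.some).2
            exact isOpen_interior.mem_nhds (hsub (hqO η n ⟨z, hzI⟩ hzq)))
        exact ⟨α, fun _ => hα⟩
      · exact ⟨hθne.some, fun h => (hsub h).elim⟩
    choose α hα using hα
    obtain ⟨α₀, hα₀⟩ := exists_forall_lt_of_lift_mk_lt hθ
      (ι := (ℵ₁ : Cardinal.{u}).ord.ToType × ULift.{u} ℕ)
      (Cardinal.lift_lt.2 (by
        rw [Cardinal.mk_prod]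
        simp only [Cardinal.mk_ord_toType, Cardinal.lift_id, Cardinal.mk_uLift, Cardinal.mk_nat,
          Cardinal.lift_aleph0]
        exact Cardinal.mul_lt_of_lt hθ0.le hθ1 hθ0))
      (fun i => α i.1 i.2.down)
    refine mem_map.2 (mem_of_superset (Ici_mem_atTop α₀) fun β hβ => hW'W ?_)
    refine closure_minimal ?_ hW'c (hd β γ)
    rintro _ ⟨η, hη, rfl⟩
    refine hW'c.closure_subset (mem_closure_of_mapClusterPt (hb β η) ?_)
    filter_upwards [hγ η hη] with n hn
    exact interior_subset (hα η n hn
      ⟨hHanti ((hα₀ (η, ⟨n⟩)).le.trans hβ) (hvH β η n), hvq β η n⟩)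
  exact Set.disjoint_left.1 hId p.2 (hrad.mem_of_tendsto hθ hdA hlim)

theorem IsPseudoradial.prod (hpse : pseudoradialNumber ≤ ℵ_ 2)
    {X Y : Type u} [TopologicalSpace X] [CompactSpace X] [T2Space X]
    [TopologicalSpace Y] [CompactSpace Y] [T2Space Y]
    (hX : IsPseudoradial X) (hY : IsPseudoradial Y)
    (hXY : ∀ A : Set (X × Y), IsRadiallyClosed A →
      ∀ C : Set (X × Y), C.Countable → C ⊆ A → closure C ⊆ A) :
    IsPseudoradial (X × Y) := by
  rw [isPseudoradial_iff]
  intro A hA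
  exact isClosed_of_isRadiallyClosed
    ((hX.noIndependentFamily hpse).prod (hY.noIndependentFamily hpse)) hA (hXY A hA)
    fun a ha => exists_cluster_mem_of_prod hX hY hA (hXY A hA) ha

theorem mainTheorem3 (hpse : pseudoradialNumber ≤ ℵ_ 2)
    (X : Type u) [TopologicalSpace X] [CompactSpace X] [T2Space X]
    (Y : Type v) [TopologicalSpace Y] [CompactSpace Y] [T2Space Y]
    (hX : IsPseudoradial X) (hY : IsPseudoradial Y)
    (hXY : IsWeaklyPseudoradial (X × Y)) :
    IsPseudoradial (X × Y) := by
  -- Lifting both factors to a common universe reduces to `IsPseudoradial.prod`.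
  have hX' : IsPseudoradial (ULift.{v} X) := hX.of_surjective continuous_uliftUp ULift.up_surjective
  have hY' : IsPseudoradial (ULift.{u} Y) := hY.of_surjective continuous_uliftUp ULift.up_surjective
  let φ : X × Y ≃ₜ ULift.{v} X × ULift.{u} Y :=
    (Homeomorph.ulift.prodCongr Homeomorph.ulift).symm
  refine (IsPseudoradial.prod hpse hX' hY' fun A hA C hC hCA => ?_).of_surjective
    φ.symm.continuous φ.symm.surjective
  have h := hXY.closure_subset (hA.preimage φ.continuous) (hC.preimage φ.injective)
    (preimage_mono hCA)
  rw [← φ.preimage_closure] at h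
  exact φ.surjective.preimage_subset_preimage_iff.1 h
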